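/- For an integer $\epsilon>0$ let $H(\epsilon)=\left\lfloor \frac{7+\sqrt{24\epsilon+1}}{2}\right\rfloor$. Let $S_\epsilon$ be a connected closed surface (orientable or not) of Euler genus $\epsilon$, that is, of Euler characteristic $2-\epsilon$, and let $G$ be a finite simple graph embedded on $S_\epsilon$ ($G$ need not be connected, and the embedding need not be cellular). A face is a connected component of $S_\epsilon\setminus G$, and for a face $F$ let $V(F)$ be the set of vertices of $G$ on the boundary of $F$. Let each vertex $v$ of $G$ have a finite list $L(v)$ of colors. Suppose that - every vertex $v$ has either $\deg(v)=|L(v)|=H(\epsilon)-2$ or $\deg(v)=|L(v)|=H(\epsilon)$; - there is a face $F$ such that every vertex of degree $H(\epsilon)-2$ lies in $V(F)$; - the subgraph of $G$ induced on $V(F)$ contains no complete graph $K_{H(\epsilon)-1}$. Then $G$ can be $L$-list-colored: one can choose a color $c(v)\in L(v)$ for every vertex $v$ such that $c(u)\ne c(v)$ whenever $u$ and $v$ are adjacent. -/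

import Mathlib

/-!
Closed surfaces are given by finite cell decompositions (polygons glued along their sides), encoded
by flags; an embedded graph is a subgraph of the 1-skeleton of such a decomposition. The
decomposition is arbitrary (loops, multiple edges and polygons with any number of sides are
allowed, orientable or not), and every embedding of a finite graph in a closed surface, cellular or
not, extends to such a decomposition by drawing additional vertices and edges inside the faces.
-/

/-- A connected closed surface with a finite cell decomposition. A flag is a triangle of the
barycentric subdivision: an incident triple (vertex, edge end, side of the edge). Each flag `x` is
glued to exactly three others: `flip0 x` (same edge and face, other end of the edge), `flip1 x`
(same vertex and face, other edge of the face at that corner) and `flip2 x` (same vertex and edge,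
other side of the edge). An edge consists of exactly four flags, and the boundary is empty. -/
structure CellSurface where
  /-- The flags of the decomposition. -/
  Flag : Type*
  [finite_flag : Finite Flag]
  [nonempty_flag : Nonempty Flag]
  flip0 : Flag → Flag
  flip1 : Flag → Flag
  flip2 : Flag → Flag
  flip0_flip0 : ∀ x, flip0 (flip0 x) = x
  flip1_flip1 : ∀ x, flip1 (flip1 x) = x
  flip2_flip2 : ∀ x, flip2 (flip2 x) = x
  flip0_ne : ∀ x, flip0 x ≠ x
  flip1_ne : ∀ x, flip1 x ≠ x
  flip2_ne : ∀ x, flip2 x ≠ x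
  flip0_flip2 : ∀ x, flip0 (flip2 x) = flip2 (flip0 x)
  flip0_flip2_ne : ∀ x, flip0 (flip2 x) ≠ x
  connected : ∀ x y, Relation.ReflTransGen
    (fun x y => y = flip0 x ∨ y = flip1 x ∨ y = flip2 x) x y

namespace CellSurface

attribute [instance] CellSurface.finite_flag CellSurface.nonempty_flag

variable (S : CellSurface)

/-- The vertices (0-cells): flags up to `flip1` and `flip2`. -/
def Vertex := Quot (fun x y : S.Flag => y = S.flip1 x ∨ y = S.flip2 x)

/-- The edges (1-cells): flags up to `flip0` and `flip2`. -/
def Edge := Quot (fun x y : S.Flag => y = S.flip0 x ∨ y = S.flip2 x)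

/-- The polygons (2-cells): flags up to `flip0` and `flip1`. -/
def Polygon := Quot (fun x y : S.Flag => y = S.flip0 x ∨ y = S.flip1 x)

/-- The vertex of a flag. -/
def vertexOf (x : S.Flag) : S.Vertex := Quot.mk _ x

/-- The edge of a flag. -/
def edgeOf (x : S.Flag) : S.Edge := Quot.mk _ x

/-- The Euler characteristic of the surface. -/
noncomputable def eulerChar : ℤ :=
  (Nat.card S.Vertex : ℤ) - (Nat.card S.Edge : ℤ) + (Nat.card S.Polygon : ℤ)

/-- The Euler genus of the surface: twice the number of handles, or the number of crosscaps. -/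
noncomputable def eulerGenus : ℤ := 2 - S.eulerChar

end CellSurface

/-- An embedding of the graph `G` in the surface `S`: distinct vertices of `G` are distinct points
(0-cells), distinct edges of `G` are distinct arcs (1-cells), and each arc joins the two points that
are the ends of the edge. -/
structure GraphEmbedding {V : Type*} (G : SimpleGraph V) (S : CellSurface) where
  vertexMap : V → S.Vertex
  edgeMap : G.edgeSet → S.Edge
  vertexMap_injective : Function.Injective vertexMap
  edgeMap_injective : Function.Injective edgeMap
  ends : ∀ (e : G.edgeSet) (x : S.Flag), S.edgeOf x = edgeMap e →
    s(S.vertexOf x, S.vertexOf (S.flip0 x)) = Sym2.map vertexMap e.1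

namespace GraphEmbedding

variable {V : Type*} {G : SimpleGraph V} {S : CellSurface} (φ : GraphEmbedding G S)

/-- The faces of the embedded graph, that is, the connected components of the complement of the
graph in the surface: one moves freely inside a polygon, and from a polygon to a neighbouring one
across any edge of the decomposition that is not an edge of the graph. (Moving through a vertex of
the decomposition that is not in the graph is covered: no edge at it belongs to the graph.) -/
def Face := Quot (fun x y : S.Flag =>
  y = S.flip0 x ∨ y = S.flip1 x ∨ (y = S.flip2 x ∧ S.edgeOf x ∉ Set.range φ.edgeMap))

/-- The face of the embedded graph that contains a flag. -/
def faceOf (x : S.Flag) : φ.Face := Quot.mk _ x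

/-- `V(F)`: the vertices of the graph that lie on (the boundary of) the face `F`. -/
def faceVertices (F : φ.Face) : Set V :=
  {v | ∃ x : S.Flag, S.vertexOf x = φ.vertexMap v ∧ φ.faceOf x = F}

end GraphEmbedding

/-- The Heawood number `H(ε) = ⌊(7 + √(24 ε + 1)) / 2⌋`. -/
noncomputable def heawood (ε : ℕ) : ℕ := ⌊(7 + Real.sqrt (24 * (ε : ℝ) + 1)) / 2⌋₊

/-- `G` can be `L`-list-colored: there is a proper coloring that uses at each vertex a color from
its list. -/
def ListColorable {V C : Type*} (G : SimpleGraph V) (L : V → Finset C) : Prop :=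
  ∃ c : G.Coloring C, ∀ v, c v ∈ L v

/-! Write H for H(ε), and suppose that no `L`-coloring exists. Every list is as large as the degree,
so some component is not degree-choosable (`exists_isBad`). By an argument in the style of Gallai
and Erdős–Rubin–Taylor, such a component is a brick or has two end bricks, each attached through a
single vertex (`IsBad.isBrick_or_hasTwoEndBricks`). The full block structure and the parity of
cycles are not needed: since H ≥ 6, all degrees are at least 4, so a brick containing all neighbors
of one of its vertices is complete, of order H - 1 or H + 1.

Heawood's bound excludes order H + 1 (`card_ne_heawood_add_one`). Hence the brick is a K_{H-1}, and
its vertices, except perhaps the attaching one, have degree H - 2 and lie on F. If the whole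
component is a brick, it is a forbidden clique in V(F). Otherwise there are two end bricks; the
degree bounds make them disjoint, and `not_two_cliques` rules them out.

Both topological exclusions count only the edges of the cliques. The faces of that subgraph need not
be discs, so Euler's formula is replaced by an inequality from mod 2 homology (`card_add_card_le`),
valid for any set of edges of the cell decomposition. Simplicity gives every face at least three
sides. A face containing 2(H - 2) clique vertices has at least that many sides, which leaves too few
faces for the Euler inequality. -/

namespace SimpleGraph

/-! ### Induced subgraphs and greedy list coloring -/

open Finset
open scoped Classical

variable {V C : Type*} (G : SimpleGraph V)

/-- `T` is a union of connected components of the subgraph induced on `S`. -/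
def ClosedIn (S T : Finset V) : Prop :=
  T ⊆ S ∧ ∀ u ∈ T, ∀ v ∈ S, G.Adj u v → v ∈ T

/-- The subgraph induced on `S` has no nontrivial union of components. -/
def ConnectedOn (S : Finset V) : Prop :=
  ∀ T, G.ClosedIn S T → T.Nonempty → T = S

/-- The degree of `v` into `S`. -/
noncomputable def degreeOn (S : Finset V) (v : V) : ℕ := #{u ∈ S | G.Adj v u}

/-- The subgraph induced on `S` has a proper coloring from the lists `L`. -/
def ListColorableOn (L : V → Finset C) (S : Finset V) : Prop :=
  ∃ c : V → C, (∀ v ∈ S, c v ∈ L v) ∧ ∀ u ∈ S, ∀ v ∈ S, G.Adj u v → c u ≠ c v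

variable {G} {S T U : Finset V} {L : V → Finset C}

lemma ClosedIn.sdiff (h : G.ClosedIn S T) : G.ClosedIn S (S \ T) := by
  refine ⟨sdiff_subset, fun u hu v hv huv => ?_⟩
  rw [mem_sdiff] at hu ⊢
  exact ⟨hv, fun hvT => hu.2 (h.2 v hvT u hu.1 huv.symm)⟩

lemma ClosedIn.trans (hT : G.ClosedIn S T) (hU : G.ClosedIn T U) : G.ClosedIn S U :=
  ⟨hU.1.trans hT.1, fun u hu v hv huv => hU.2 u hu v (hT.2 u (hU.1 hu) v hv huv) huv⟩

lemma degreeOn_mono (h : T ⊆ S) (v : V) : G.degreeOn T v ≤ G.degreeOn S v :=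
  card_le_card (filter_subset_filter _ h)

lemma degreeOn_erase_add_one {u v : V} (hv : v ∈ S) (huv : G.Adj u v) :
    G.degreeOn (S.erase v) u + 1 = G.degreeOn S u := by
  unfold degreeOn
  rw [filter_erase, card_erase_add_one]
  simp [hv, huv]

lemma degreeOn_erase_of_not_adj {u v : V} (huv : ¬ G.Adj u v) :
    G.degreeOn (S.erase v) u = G.degreeOn S u := by
  unfold degreeOn
  rw [filter_erase, erase_eq_of_notMem]
  simp [huv]

lemma degreeOn_lt {u v : V} (h : T ⊆ S) (hv : v ∈ S) (hvT : v ∉ T) (huv : G.Adj u v) :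
    G.degreeOn T u < G.degreeOn S u := by
  have h1 : T ⊆ S.erase v := fun w hw => mem_erase.2 ⟨fun e => hvT (e ▸ hw), h hw⟩
  have := degreeOn_mono (G := G) h1 u
  have := degreeOn_erase_add_one hv huv
  omega

lemma degreeOn_eq_of_closed (h : T ⊆ S) {u : V} (hu : ∀ v ∈ S, G.Adj u v → v ∈ T) :
    G.degreeOn T u = G.degreeOn S u := by
  unfold degreeOn
  congr 1
  ext v
  simp only [mem_filter]
  exact ⟨fun ⟨a, b⟩ => ⟨h a, b⟩, fun ⟨a, b⟩ => ⟨hu v a b, b⟩⟩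

lemma degreeOn_of_isClique (h : G.IsClique (T : Set V)) {u : V} (hu : u ∈ T) :
    G.degreeOn T u = #T - 1 := by
  unfold degreeOn
  rw [← card_erase_of_mem hu]
  congr 1
  ext v
  simp only [mem_filter, mem_erase]
  exact ⟨fun ⟨a, b⟩ => ⟨b.ne', a⟩, fun ⟨a, b⟩ => ⟨b, h hu b (Ne.symm a)⟩⟩

lemma isClique_of_degreeOn (h : ∀ u ∈ T, #T ≤ G.degreeOn T u + 1) :
    G.IsClique (T : Set V) := by
  intro u hu v hv huv
  by_contra hn
  have h1 : ({w ∈ T | G.Adj u w} : Finset V) ⊆ (T.erase u).erase v := by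
    intro w hw
    simp only [mem_filter] at hw
    simp only [mem_erase]
    exact ⟨fun e => hn (e ▸ hw.2), hw.2.ne', hw.1⟩
  have h2 := card_le_card h1
  have h3 : v ∈ T.erase u := mem_erase.2 ⟨huv.symm, hv⟩
  have h4 := card_erase_add_one h3
  have h5 := card_erase_add_one (show u ∈ T from hu)
  have := h u hu
  unfold degreeOn at this
  omega

/-- Greedy coloring: it suffices that every union of components has a vertex with more colors than
neighbors. -/
theorem listColorableOn_of_surplus [Nonempty C] (hd : ∀ v ∈ S, G.degreeOn S v ≤ #(L v))
    (h : ∀ T, G.ClosedIn S T → T.Nonempty → ∃ v ∈ T, G.degreeOn S v < #(L v)) :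
    G.ListColorableOn L S := by
  induction hn : #S generalizing S with
  | zero =>
    rw [card_eq_zero] at hn
    subst hn
    exact ⟨fun _ => Classical.arbitrary C, by simp⟩
  | succ n ih =>
    have hS : S.Nonempty := card_pos.1 (by omega)
    obtain ⟨v, hv, hlt⟩ := h S ⟨Subset.rfl, fun _ _ _ h _ => h⟩ hS
    -- The surplus vertex `v` is colored last. A union of components of `S - v` either contains a
    -- neighbor of `v`, which gains a surplus, or is already closed in `S`.
    obtain ⟨c, hcL, hc⟩ := ih (S := S.erase v)
      (fun u hu => (degreeOn_mono (erase_subset _ _) u).trans (hd u (mem_of_mem_erase hu)))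
      (by
        intro T hT hTne
        by_cases hadj : ∃ u ∈ T, G.Adj u v
        · obtain ⟨u, hu, huv⟩ := hadj
          have huS := mem_of_mem_erase (hT.1 hu)
          refine ⟨u, hu, ?_⟩
          have := degreeOn_erase_add_one hv huv
          have := hd u huS
          omega
        · push Not at hadj
          obtain ⟨u, hu, hlt⟩ := h T ⟨hT.1.trans (erase_subset _ _), fun u hu w hw huw =>
            hT.2 u hu w (mem_erase.2 ⟨fun e => hadj u hu (e ▸ huw), hw⟩) huw⟩ hTne
          exact ⟨u, hu, (degreeOn_mono (erase_subset _ _) u).trans_lt hlt⟩)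
      (by rw [card_erase_of_mem hv, hn]; rfl)
    have : #(image c {u ∈ S | G.Adj v u}) < #(L v) := card_image_le.trans_lt hlt
    obtain ⟨a, ha, hna⟩ := exists_mem_notMem_of_card_lt_card this
    have hna' : ∀ u ∈ S, G.Adj v u → c u ≠ a := fun u hu huv e =>
      hna (mem_image.2 ⟨u, mem_filter.2 ⟨hu, huv⟩, e⟩)
    refine ⟨Function.update c v a, fun u hu => ?_, fun u hu w hw huw => ?_⟩
    · rcases eq_or_ne u v with rfl | hne
      · simpa
      · simpa [hne] using hcL u (mem_erase.2 ⟨hne, hu⟩)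
    · rcases eq_or_ne u v with rfl | hne
      · simpa [huw.ne'] using (hna' w hw huw).symm
      · rcases eq_or_ne w v with rfl | hne'
        · simpa [hne] using hna' u hu huw.symm
        · simpa [hne, hne'] using hc u (mem_erase.2 ⟨hne, hu⟩) w (mem_erase.2 ⟨hne', hw⟩) huw

end SimpleGraph

/-! ### Bricks and degree-choosability -/

namespace SimpleGraph

open Finset
open scoped Classical

variable {V C : Type*} (G : SimpleGraph V)

/-- A complete subgraph or a 2-regular one. -/
def IsBrick (B : Finset V) : Prop :=
  G.IsClique (B : Set V) ∨ ∀ v ∈ B, G.degreeOn B v = 2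

/-- A brick `B` attached to the rest of `S` at most at its vertex `x`. -/
structure IsEndBrick (S B : Finset V) (x : V) : Prop where
  subset : B ⊆ S
  mem : x ∈ B
  nonempty : (B.erase x).Nonempty
  adj_mem : ∀ b ∈ B.erase x, ∀ u ∈ S, G.Adj b u → u ∈ B
  isBrick : G.IsBrick B

/-- A connected part that is not colorable from lists as large as the degrees. -/
structure IsBad (L : V → Finset C) (S : Finset V) : Prop where
  connected : G.ConnectedOn S
  degree_le : ∀ v ∈ S, G.degreeOn S v ≤ #(L v)
  not_colorable : ¬ G.ListColorableOn L S

/-- There are two end bricks that share at most their attaching vertices. -/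
def HasTwoEndBricks (S : Finset V) : Prop :=
  ∃ B₁ x₁ B₂ x₂, G.IsEndBrick S B₁ x₁ ∧ G.IsEndBrick S B₂ x₂ ∧
    Disjoint (B₁.erase x₁) (B₂.erase x₂)

variable {G} {S T U : Finset V} {L : V → Finset C}

lemma IsBad.nonempty [Nonempty C] (h : G.IsBad L S) : S.Nonempty := by
  by_contra hS
  rw [not_nonempty_iff_eq_empty] at hS
  subst hS
  exact h.not_colorable ⟨fun _ => Classical.arbitrary C, by simp, by simp⟩

/-- One surplus vertex in a connected set already permits greedy coloring, so in a bad set list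
sizes and degrees coincide. -/
lemma IsBad.card_le_degreeOn [Nonempty C] (h : G.IsBad L S) {v : V} (hv : v ∈ S) :
    #(L v) ≤ G.degreeOn S v := by
  by_contra hlt
  refine h.not_colorable (listColorableOn_of_surplus h.degree_le fun T hT hne => ?_)
  rw [h.connected T hT hne]
  exact ⟨v, hv, not_le.1 hlt⟩

/-- A nonempty union of components of `S - x` contains a neighbor of `x`. -/
lemma ConnectedOn.exists_adj (h : G.ConnectedOn S) {x : V} (hx : x ∈ S)
    (hT : G.ClosedIn (S.erase x) T) (hne : T.Nonempty) : ∃ u ∈ T, G.Adj u x := by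
  by_contra! hadj
  have : T = S := h T ⟨hT.1.trans (erase_subset _ _), fun u hu w hw huw =>
    hT.2 u hu w (mem_erase.2 ⟨fun e => hadj u hu (e ▸ huw), hw⟩) huw⟩ hne
  exact notMem_erase x S (hT.1 (this ▸ hx))

/-- The other side of `x` can be colored greedily towards `x`. Removing from the list of `x` the
colors used on its neighbors there costs no more colors than `x` loses neighbors, and a coloring of
the remaining side would complete one of `S`. This lets the induction split at a cutvertex. -/
lemma IsBad.insert_side [Nonempty C] (h : G.IsBad L S) {x : V} (hx : x ∈ S)
    (hT : G.ClosedIn (S.erase x) T) : ∃ L' : V → Finset C, G.IsBad L' (insert x T) := by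
  have hxT : x ∉ T := fun h => notMem_erase x S (hT.1 h)
  have hTS : T ⊆ S := hT.1.trans (erase_subset _ _)
  have hsub : insert x T ⊆ S := insert_subset hx hTS
  set D := S.erase x \ T with hD
  have hDS : D ⊆ S := sdiff_subset.trans (erase_subset _ _)
  have hxD : x ∉ D := by simp [hD]
  obtain ⟨f, hfL, hf⟩ : G.ListColorableOn L D := by
    refine listColorableOn_of_surplus
      (fun v hv => (degreeOn_mono hDS v).trans (h.degree_le v (hDS hv))) fun U hU hne => ?_
    obtain ⟨u, hu, hux⟩ := h.connected.exists_adj hx (hT.sdiff.trans hU) hne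
    exact ⟨u, hu, (degreeOn_lt hDS hx hxD hux).trans_le (h.degree_le u (hDS (hU.1 hu)))⟩
  refine ⟨Function.update L x (L x \ image f {u ∈ D | G.Adj x u}), ?_, ?_, ?_⟩
  · intro U hU hne
    by_cases hxU : x ∈ U
    · by_contra hUne
      have hc := hU.sdiff
      have hW : (insert x T \ U).Nonempty := by
        rw [sdiff_nonempty]
        exact fun hs => hUne (hU.1.antisymm hs)
      have hWT : insert x T \ U ⊆ T := fun w hw => by
        rw [mem_sdiff, mem_insert] at hw
        exact hw.1.resolve_left fun e => hw.2 (e ▸ hxU)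
      have hW' : G.ClosedIn (S.erase x) (insert x T \ U) :=
        hT.trans ⟨hWT, fun u hu v hv huv => hc.2 u hu v (mem_insert_of_mem hv) huv⟩
      obtain ⟨u, hu, hux⟩ := h.connected.exists_adj hx hW' hW
      exact (mem_sdiff.1 (hc.2 u hu x (mem_insert_self _ _) hux)).2 hxU
    · have hUT : U ⊆ T := fun w hw => (mem_insert.1 (hU.1 hw)).resolve_left fun e => hxU (e ▸ hw)
      have hU' : G.ClosedIn (S.erase x) U :=
        hT.trans ⟨hUT, fun u hu v hv huv => hU.2 u hu v (mem_insert_of_mem hv) huv⟩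
      obtain ⟨u, hu, hux⟩ := h.connected.exists_adj hx hU' hne
      exact absurd (hU.2 u hu x (mem_insert_self _ _) hux) hxU
  · intro v hv
    rcases eq_or_ne v x with rfl | hne
    · rw [Function.update_self]
      have h1 := h.degree_le v hx
      have h2 := le_card_sdiff (image f {u ∈ D | G.Adj v u}) (L v)
      have h3 : #(image f {u ∈ D | G.Adj v u}) ≤ G.degreeOn D v := card_image_le
      have h4 : G.degreeOn (insert v T) v + G.degreeOn D v ≤ G.degreeOn S v := by
        unfold degreeOn
        rw [← card_union_of_disjoint]
        · refine card_le_card ?_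
          rw [← filter_union]
          exact filter_subset_filter _ (union_subset hsub hDS)
        · refine disjoint_filter_filter (Finset.disjoint_left.2 fun a ha haD => ?_)
          rcases mem_insert.1 ha with rfl | ha
          · exact hxD haD
          · exact (mem_sdiff.1 haD).2 ha
      omega
    · rw [Function.update_of_ne hne]
      exact (degreeOn_mono hsub v).trans (h.degree_le v (hsub hv))
  · rintro ⟨g, hgL, hg⟩
    have hgx := hgL x (mem_insert_self _ _)
    rw [Function.update_self, mem_sdiff] at hgx
    have hcross : ∀ u ∈ insert x T, ∀ v ∈ D, G.Adj u v → g u ≠ f v := by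
      intro u hu v hv huv
      rcases mem_insert.1 hu with rfl | hu
      · intro e
        exact hgx.2 (mem_image.2 ⟨v, mem_filter.2 ⟨hv, huv⟩, e.symm⟩)
      · exact absurd (hT.2 u hu v (mem_sdiff.1 hv).1 huv) (mem_sdiff.1 hv).2
    have hsplit : ∀ v ∈ S, v ∉ insert x T → v ∈ D := by
      intro v hv hn
      rw [mem_insert, not_or] at hn
      exact mem_sdiff.2 ⟨mem_erase.2 ⟨hn.1, hv⟩, hn.2⟩
    refine h.not_colorable ⟨fun v => if v ∈ insert x T then g v else f v, fun v hv => ?_,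
      fun u hu v hv huv => ?_⟩
    · dsimp only
      split_ifs with hvT
      · have := hgL v hvT
        rcases eq_or_ne v x with rfl | hne
        · exact hgx.1
        · rwa [Function.update_of_ne hne] at this
      · exact hfL v (hsplit v hv hvT)
    · dsimp only
      split_ifs with huT hvT hvT
      · exact hg u huT v hvT huv
      · exact hcross u huT v (hsplit v hv hvT) huv
      · exact (hcross v hvT u (hsplit u hu huT) huv.symm).symm
      · exact hf u (hsplit u hu huT) v (hsplit v hv hvT) huv

/-- If the side with `x` is a brick, it is attached at `x`. Otherwise `x` lies in the interior of at
most one of the two end bricks, and the other remains an end brick of `S`. -/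
lemma exists_isEndBrick_side {x : V} (hx : x ∈ S)
    (hT : G.ClosedIn (S.erase x) T) (hne : T.Nonempty)
    (hb : G.IsBrick (insert x T) ∨ G.HasTwoEndBricks (insert x T)) :
    ∃ B y, G.IsEndBrick S B y ∧ B.erase y ⊆ T := by
  have hxT : x ∉ T := fun h => notMem_erase x S (hT.1 h)
  have hTS : T ⊆ S := hT.1.trans (erase_subset _ _)
  have hsub : insert x T ⊆ S := insert_subset hx hTS
  have hstep : ∀ b ∈ T, ∀ u ∈ S, G.Adj b u → u ∈ insert x T := by
    intro b hb u hu hbu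
    rcases eq_or_ne u x with rfl | hne
    · exact mem_insert_self _ _
    · exact mem_insert_of_mem (hT.2 b hb u (mem_erase.2 ⟨hne, hu⟩) hbu)
  rcases hb with hb | ⟨B₁, x₁, B₂, x₂, h₁, h₂, hdis⟩
  · refine ⟨insert x T, x, ⟨hsub, mem_insert_self _ _, ?_, ?_, hb⟩, ?_⟩ <;>
      rw [erase_insert hxT]
    exacts [hne, hstep]
  · have key : ∀ B y, G.IsEndBrick (insert x T) B y → x ∉ B.erase y →
        ∃ B y, G.IsEndBrick S B y ∧ B.erase y ⊆ T := by
      intro B y hB hxB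
      have hBT : B.erase y ⊆ T := fun b hb =>
        (mem_insert.1 (hB.subset (mem_of_mem_erase hb))).resolve_left fun e => hxB (e ▸ hb)
      exact ⟨B, y, ⟨hB.subset.trans hsub, hB.mem, hB.nonempty, fun b hb u hu hbu =>
        hB.adj_mem b hb u (hstep b (hBT hb) u hu hbu) hbu, hB.isBrick⟩, hBT⟩
    by_cases hx1 : x ∈ B₁.erase x₁
    · exact key B₂ x₂ h₂ (Finset.disjoint_left.1 hdis hx1)
    · exact key B₁ x₁ h₁ hx1

/-- Deleting a vertex and one of its colors. -/
lemma IsBad.erase [Nonempty C] (h : G.IsBad L S) {v : V} (hv : v ∈ S)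
    (hcon : G.ConnectedOn (S.erase v)) {a : C} (ha : a ∈ L v) :
    G.IsBad (fun u => if G.Adj u v then (L u).erase a else L u) (S.erase v) := by
  refine ⟨hcon, fun u hu => ?_, ?_⟩
  · have := h.degree_le u (mem_of_mem_erase hu)
    split_ifs with huv
    · have := degreeOn_erase_add_one hv huv
      have := pred_card_le_card_erase (s := L u) (a := a)
      omega
    · rwa [degreeOn_erase_of_not_adj huv]
  · rintro ⟨c, hcL, hc⟩
    refine h.not_colorable ⟨Function.update c v a, fun u hu => ?_, fun u hu w hw huw => ?_⟩
    · rcases eq_or_ne u v with rfl | hne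
      · simpa
      · have := hcL u (mem_erase.2 ⟨hne, hu⟩)
        dsimp only at this
        rw [Function.update_of_ne hne]
        split_ifs at this
        exacts [mem_of_mem_erase this, this]
    · have hna : ∀ w ∈ S, G.Adj w v → c w ≠ a := by
        intro w hw hwv
        have := hcL w (mem_erase.2 ⟨hwv.ne, hw⟩)
        simp only [hwv, if_true] at this
        exact ne_of_mem_erase this
      rcases eq_or_ne u v with rfl | hne
      · simpa [huw.ne'] using (hna w hw huw.symm).symm
      · rcases eq_or_ne w v with rfl | hne'
        · simpa [hne] using hna u hu huw
        · simpa [hne, hne'] using hc u (mem_erase.2 ⟨hne, hu⟩) w (mem_erase.2 ⟨hne', hw⟩) huw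

/-- Without cutvertices the lists, hence the degrees, agree. -/
lemma IsBad.degreeOn_eq [Nonempty C] (h : G.IsBad L S)
    (hcut : ∀ v ∈ S, G.ConnectedOn (S.erase v)) {v w : V} (hv : v ∈ S) (hw : w ∈ S) :
    G.degreeOn S w = G.degreeOn S v := by
  have hle : ∀ u ∈ S, ∀ v ∈ S, G.Adj u v → G.degreeOn S v ≤ G.degreeOn S u := by
    intro u hu v hv huv
    -- If a color `a` of `v` were missing from `L u`, coloring `v` with `a` would give `u` a surplus
    -- in the bad set `S - v`.
    have hLL : L v ⊆ L u := by
      intro a ha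
      by_contra hau
      have hbad := h.erase hv (hcut v hv) ha
      have h1 := hbad.card_le_degreeOn (mem_erase.2 ⟨huv.ne, hu⟩)
      simp only [huv, if_true, erase_eq_of_notMem hau] at h1
      have := degreeOn_erase_add_one hv huv
      have := h.degree_le u hu
      omega
    have := card_le_card hLL
    have := h.degree_le v hv
    have := h.card_le_degreeOn hu
    omega
  have := h.connected {w ∈ S | G.degreeOn S w = G.degreeOn S v}
    ⟨filter_subset _ _, fun u hu w hw huw => by
      rw [mem_filter] at hu ⊢
      refine ⟨hw, ?_⟩
      have := hle u hu.1 w hw huw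
      have := hle w hw u hu.1 huw.symm
      omega⟩ ⟨v, mem_filter.2 ⟨hv, rfl⟩⟩
  rw [← this, mem_filter] at hw
  exact hw.2

lemma IsBrick.degreeOn_eq {B : Finset V} (h : G.IsBrick B) {b b' : V} (hb : b ∈ B)
    (hb' : b' ∈ B) : G.degreeOn B b = G.degreeOn B b' := by
  rcases h with h | h
  · rw [degreeOn_of_isClique h hb, degreeOn_of_isClique h hb']
  · rw [h b hb, h b' hb']

lemma degreeOn_lt_card {B : Finset V} {b : V} (hb : b ∈ B) : G.degreeOn B b < #B :=
  card_lt_card ⟨filter_subset _ _, fun hs => by simpa using hs hb⟩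

/-- In a regular graph without cutvertices, an end brick of `S - v` is almost completely joined
to `v`. -/
lemma IsEndBrick.le_card_adj {k : ℕ}
    (hcut : ∀ v ∈ S, G.ConnectedOn (S.erase v)) (hk : ∀ v ∈ S, G.degreeOn S v = k) {v : V}
    (hv : v ∈ S) {B : Finset V} {x : V} (hB : G.IsEndBrick (S.erase v) B x) :
    1 ≤ k ∧ k ≤ #(B.erase x) + 1 ∧ ∀ b ∈ B.erase x, G.Adj b v := by
  have hBx : ∀ b ∈ B.erase x, b ∈ B := fun b hb => mem_of_mem_erase hb
  have hxS : x ∈ S := mem_of_mem_erase (hB.subset hB.mem)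
  have hxv : x ≠ v := ne_of_mem_erase (hB.subset hB.mem)
  -- Otherwise `x` would separate `B - x` from `v` in `S`.
  obtain ⟨b₀, hb₀, hadj₀⟩ : ∃ b ∈ B.erase x, G.Adj b v := by
    by_contra! hno
    have hcl : G.ClosedIn (S.erase x) (B.erase x) := by
      refine ⟨fun b hb => mem_erase.2 ⟨ne_of_mem_erase hb,
        mem_of_mem_erase (hB.subset (hBx b hb))⟩, fun b hb u hu hbu => ?_⟩
      refine mem_erase.2 ⟨ne_of_mem_erase hu, hB.adj_mem b hb u (mem_erase.2 ⟨?_,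
        mem_of_mem_erase hu⟩) hbu⟩
      rintro rfl
      exact hno b hb hbu
    have := hcut x hxS _ hcl hB.nonempty
    have hvB : v ∈ B.erase x := this ▸ mem_erase.2 ⟨hxv.symm, hv⟩
    exact notMem_erase v S (hB.subset (hBx v hvB))
  have hdeg : ∀ b ∈ B.erase x, G.degreeOn B b = G.degreeOn (S.erase v) b := fun b hb =>
    degreeOn_eq_of_closed hB.subset (hB.adj_mem b hb)
  have hbS : ∀ b ∈ B.erase x, b ∈ S := fun b hb => mem_of_mem_erase (hB.subset (hBx b hb))
  have h0 := degreeOn_erase_add_one hv hadj₀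
  rw [hk b₀ (hbS b₀ hb₀), ← hdeg b₀ hb₀] at h0
  have h1 := degreeOn_lt_card (G := G) (hBx b₀ hb₀)
  have h2 := card_erase_add_one hB.mem
  refine ⟨by omega, by omega, fun b hb => ?_⟩
  -- Bricks are regular, so `b` has, like `b₀`, only `k - 1` neighbors in `B`; the missing neighbor
  -- must be `v`.
  by_contra hn
  have h3 := degreeOn_erase_of_not_adj (S := S) hn
  rw [hk b (hbS b hb), ← hdeg b hb, hB.isBrick.degreeOn_eq (hBx b hb) (hBx b₀ hb₀)] at h3
  omega

/-- The structure of the connected graphs that are not degree-choosable: they are bricks or have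
two end bricks. -/
theorem IsBad.isBrick_or_hasTwoEndBricks [Nonempty C] (h : G.IsBad L S) :
    G.IsBrick S ∨ G.HasTwoEndBricks S := by
  induction hn : #S using Nat.strong_induction_on generalizing S L with
  | _ n ih =>
  subst hn
  by_cases hcut : ∀ v ∈ S, G.ConnectedOn (S.erase v)
  swap
  · right
    push Not at hcut
    obtain ⟨x, hx, hcon⟩ := hcut
    unfold ConnectedOn at hcon
    push Not at hcon
    obtain ⟨T, hT, hne, hTne⟩ := hcon
    have hne' : (S.erase x \ T).Nonempty := by
      rw [sdiff_nonempty]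
      exact fun hs => hTne (hT.1.antisymm hs)
    -- At a cutvertex `x`, each side together with `x` is a smaller bad set and supplies an end
    -- brick of its own.
    have hside : ∀ T, G.ClosedIn (S.erase x) T → T.Nonempty → (S.erase x \ T).Nonempty →
        ∃ B y, G.IsEndBrick S B y ∧ B.erase y ⊆ T := by
      intro T hT hne hne'
      obtain ⟨L', hL'⟩ := h.insert_side hx hT
      refine exists_isEndBrick_side hx hT hne (ih _ ?_ hL' rfl)
      refine card_lt_card ⟨insert_subset hx (hT.1.trans (erase_subset _ _)), fun hs => ?_⟩
      obtain ⟨d, hd⟩ := hne'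
      rw [mem_sdiff, mem_erase] at hd
      exact (mem_insert.1 (hs hd.1.2)).elim hd.1.1 hd.2
    obtain ⟨B₁, x₁, h₁, hs₁⟩ := hside T hT hne hne'
    obtain ⟨B₂, x₂, h₂, hs₂⟩ := hside _ hT.sdiff hne'
      (by rwa [Finset.sdiff_sdiff_eq_self hT.1])
    exact ⟨B₁, x₁, B₂, x₂, h₁, h₂, disjoint_sdiff.mono hs₁ hs₂⟩
  left
  obtain ⟨v, hv⟩ := h.nonempty
  obtain ⟨k, hk'⟩ : ∃ k, k = G.degreeOn S v := ⟨_, rfl⟩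
  have hk : ∀ w ∈ S, G.degreeOn S w = k := fun w hw => hk' ▸ h.degreeOn_eq hcut hv hw
  by_cases hSv : (S.erase v).Nonempty
  swap
  · left
    intro a ha b hb hab
    rw [not_nonempty_iff_eq_empty] at hSv
    by_cases hav : a = v
    · exact absurd (hSv ▸ mem_erase.2 ⟨fun e => hab (hav.trans e.symm), hb⟩ : b ∈ (∅ : Finset V))
        (notMem_empty _)
    · exact absurd (hSv ▸ mem_erase.2 ⟨hav, ha⟩ : a ∈ (∅ : Finset V)) (notMem_empty _)
  obtain ⟨u, hu, huv⟩ := h.connected.exists_adj hv ⟨Subset.rfl, fun _ _ _ h _ => h⟩ hSv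
  have huS := mem_of_mem_erase hu
  have hdu := degreeOn_erase_add_one hv huv
  rw [hk u huS] at hdu
  have hcard := card_erase_add_one hv
  obtain ⟨a, ha⟩ : (L v).Nonempty := by
    rw [← card_pos]
    have := h.degree_le v hv
    have := hk v hv
    omega
  have hlt : #(S.erase v) < #S := by omega
  rcases ih _ hlt (h.erase hv (hcut v hv) ha) rfl with (hb | hb) |
    ⟨B₁, x₁, B₂, x₂, h₁, h₂, hdis⟩
  · left
    rw [degreeOn_of_isClique hb hu] at hdu
    refine isClique_of_degreeOn fun w hw => ?_
    rw [hk w hw]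
    omega
  · left
    rw [hb u hu] at hdu
    -- Here `k = 3` while degrees in `S - v` are 2, so `v` is adjacent to everything; then `S` has
    -- at most four vertices and is complete.
    have hall : ∀ w ∈ S.erase v, G.Adj v w := by
      intro w hw
      by_contra hn
      have h1 := degreeOn_erase_of_not_adj (S := S) (mt G.adj_symm hn)
      rw [hb w hw, hk w (mem_of_mem_erase hw)] at h1
      omega
    have h1 : #(S.erase v) ≤ G.degreeOn S v := by
      refine card_le_card fun w hw => mem_filter.2 ⟨mem_of_mem_erase hw, hall w hw⟩
    rw [hk v hv] at h1
    refine isClique_of_degreeOn fun w hw => ?_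
    rw [hk w hw]
    omega
  · obtain ⟨hk1, hc1, ha1⟩ := h₁.le_card_adj hcut hk hv
    obtain ⟨-, hc2, ha2⟩ := h₂.le_card_adj hcut hk hv
    -- Each end brick contains at least `k - 1` neighbors of `v`, and at least one. Thus `2(k - 1) ≤
    -- k` and `2 ≤ k`, so `k = 2`.
    have h3 : #(B₁.erase x₁ ∪ B₂.erase x₂) ≤ G.degreeOn S v := by
      refine card_le_card fun w hw => ?_
      rw [mem_filter]
      rcases mem_union.1 hw with hw | hw
      · exact ⟨mem_of_mem_erase (h₁.subset (mem_of_mem_erase hw)), (ha1 w hw).symm⟩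
      · exact ⟨mem_of_mem_erase (h₂.subset (mem_of_mem_erase hw)), (ha2 w hw).symm⟩
    rw [card_union_of_disjoint hdis, hk v hv] at h3
    have := h₁.nonempty.card_pos
    have := h₂.nonempty.card_pos
    right
    intro w hw
    rw [hk w hw]
    omega

/-- A graph that is not colorable from lists as large as the degrees has a bad union of
components. -/
theorem exists_isBad [Nonempty C] (hd : ∀ v ∈ S, G.degreeOn S v ≤ #(L v))
    (h : ¬ G.ListColorableOn L S) : ∃ T, G.ClosedIn S T ∧ G.IsBad L T := by
  induction hn : #S using Nat.strong_induction_on generalizing S with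
  | _ n ih =>
  subst hn
  by_cases hcon : G.ConnectedOn S
  · exact ⟨S, ⟨Subset.rfl, fun _ _ _ h _ => h⟩, hcon, hd, h⟩
  unfold ConnectedOn at hcon
  push Not at hcon
  obtain ⟨T, hT, hne, hTne⟩ := hcon
  have hss : T ⊂ S := hT.1.ssubset_of_ne hTne
  have hss' : S \ T ⊂ S := sdiff_ssubset hT.1 hne
  have key : ∀ U, G.ClosedIn S U → U ⊂ S → ¬ G.ListColorableOn L U →
      ∃ T, G.ClosedIn S T ∧ G.IsBad L T := by
    intro U hU hss hUc
    obtain ⟨W, hW, hWb⟩ := ih _ (card_lt_card hss)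
      (fun v hv => (degreeOn_mono hU.1 v).trans (hd v (hU.1 hv))) hUc rfl
    exact ⟨W, hU.trans hW, hWb⟩
  by_cases h1 : G.ListColorableOn L T
  swap
  · exact key T hT hss h1
  by_cases h2 : G.ListColorableOn L (S \ T)
  swap
  · exact key _ hT.sdiff hss' h2
  obtain ⟨f, hfL, hf⟩ := h1
  obtain ⟨g, hgL, hg⟩ := h2
  refine absurd ⟨fun v => if v ∈ T then f v else g v, fun v hv => ?_, fun u hu v hv huv => ?_⟩ h
  · dsimp only
    split_ifs with hvT
    exacts [hfL v hvT, hgL v (mem_sdiff.2 ⟨hv, hvT⟩)]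
  · dsimp only
    split_ifs with huT hvT hvT
    · exact hf u huT v hvT huv
    · exact absurd (hT.2 u huT v hv huv) hvT
    · exact absurd (hT.2 v hvT u hu huv.symm) huT
    · exact hg u (mem_sdiff.2 ⟨hu, huT⟩) v (mem_sdiff.2 ⟨hv, hvT⟩) huv

end SimpleGraph

/-! ### Parity and rank -/

namespace Finset

/-- A finite set with a fixed-point-free involution has an even number of elements. -/
theorem even_card_of_involution {α : Type*} {s : Finset α} (f : α → α) (hs : ∀ x ∈ s, f x ∈ s)
    (hf : ∀ x ∈ s, f (f x) = x) (hne : ∀ x ∈ s, f x ≠ x) : Even s.card := by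
  rw [even_iff_two_dvd, ← ZMod.natCast_eq_zero_iff]
  have := sum_involution (s := s) (f := fun _ => (1 : ZMod 2)) (fun a _ => f a)
    (fun _ _ => by decide) (fun a ha _ => hne a ha) hs hf
  simpa using this

end Finset

/-- Rank–nullity: the hypothesis makes `φ` injective on the kernel of `M`, so the nullity is at most
`dim W`. -/
theorem Matrix.card_le_rank_add_one {m n : Type*} {K W : Type*} [Field K] [Fintype m] [Fintype n]
    [AddCommGroup W] [Module K W] [FiniteDimensional K W]
    (M : Matrix m n K) (φ : (n → K) →ₗ[K] W) (h : ∀ g, M.mulVec g = 0 → φ g = 0 → g = 0) :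
    Fintype.card n ≤ M.rank + Module.finrank K W := by
  have h1 := M.mulVecLin.finrank_range_add_finrank_ker
  have h2 : Module.finrank K (LinearMap.ker M.mulVecLin) ≤ Module.finrank K W := by
    refine LinearMap.finrank_le_finrank_of_injective
      (f := φ.comp (LinearMap.ker M.mulVecLin).subtype) ?_
    rw [← LinearMap.ker_eq_bot, LinearMap.ker_eq_bot']
    intro g hg
    exact Subtype.ext (h g g.2 hg)
  rw [Module.finrank_fintype_fun_eq_card] at h1
  unfold Matrix.rank
  omega

/-! ### Flags and the Euler inequality from mod 2 homology -/

namespace CellSurface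

open Finset
open scoped Classical

variable (S : CellSurface)

/-- The polygon of a flag. -/
def polygonOf (x : S.Flag) : S.Polygon := Quot.mk _ x

instance : Finite S.Vertex := inferInstanceAs (Finite (Quot _))
instance : Finite S.Edge := inferInstanceAs (Finite (Quot _))
instance : Finite S.Polygon := inferInstanceAs (Finite (Quot _))
noncomputable instance : Fintype S.Vertex := Fintype.ofFinite _
noncomputable instance : Fintype S.Edge := Fintype.ofFinite _
noncomputable instance : Fintype S.Polygon := Fintype.ofFinite _
noncomputable instance : Fintype S.Flag := Fintype.ofFinite _

/-- The components of the complement of a set of edges. -/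
def FaceOn (A : Set S.Edge) := Quot (fun x y : S.Flag =>
  y = S.flip0 x ∨ y = S.flip1 x ∨ (y = S.flip2 x ∧ S.edgeOf x ∉ A))

instance (A : Set S.Edge) : Finite (S.FaceOn A) := inferInstanceAs (Finite (Quot _))
noncomputable instance (A : Set S.Edge) : Fintype (S.FaceOn A) := Fintype.ofFinite _

/-- The component of a flag in the complement of `A`. -/
def faceOn (A : Set S.Edge) (x : S.Flag) : S.FaceOn A := Quot.mk _ x

variable {S} {A : Set S.Edge}

lemma vertexOf_flip1 (x : S.Flag) : S.vertexOf (S.flip1 x) = S.vertexOf x := by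
  symm
  exact Quot.sound (Or.inl rfl)

lemma vertexOf_flip2 (x : S.Flag) : S.vertexOf (S.flip2 x) = S.vertexOf x := by
  symm
  exact Quot.sound (Or.inr rfl)

lemma edgeOf_flip0 (x : S.Flag) : S.edgeOf (S.flip0 x) = S.edgeOf x := by
  symm
  exact Quot.sound (Or.inl rfl)

lemma edgeOf_flip2 (x : S.Flag) : S.edgeOf (S.flip2 x) = S.edgeOf x := by
  symm
  exact Quot.sound (Or.inr rfl)

lemma polygonOf_flip0 (x : S.Flag) : S.polygonOf (S.flip0 x) = S.polygonOf x := by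
  symm
  exact Quot.sound (Or.inl rfl)

lemma polygonOf_flip1 (x : S.Flag) : S.polygonOf (S.flip1 x) = S.polygonOf x := by
  symm
  exact Quot.sound (Or.inr rfl)

lemma faceOn_flip0 (x : S.Flag) : S.faceOn A (S.flip0 x) = S.faceOn A x := by
  symm
  exact Quot.sound (Or.inl rfl)

lemma faceOn_flip1 (x : S.Flag) : S.faceOn A (S.flip1 x) = S.faceOn A x := by
  symm
  exact Quot.sound (Or.inr (Or.inl rfl))

lemma faceOn_flip2 {x : S.Flag} (h : S.edgeOf x ∉ A) : S.faceOn A (S.flip2 x) = S.faceOn A x := by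
  symm
  exact Quot.sound (Or.inr (Or.inr ⟨rfl, h⟩))

lemma mem_of_flip_mem {P : S.Flag → Prop} (h0 : ∀ x, P x → P (S.flip0 x))
    (h1 : ∀ x, P x → P (S.flip1 x)) (h2 : ∀ x, P x → P (S.flip2 x)) {x : S.Flag} (hx : P x)
    (y : S.Flag) : P y := by
  induction S.connected x y with
  | refl => exact hx
  | tail _ h ih =>
    rcases h with rfl | rfl | rfl
    exacts [h0 _ ih, h1 _ ih, h2 _ ih]

/-- The flags at a vertex are connected through `flip1` and `flip2`. -/
lemma mem_of_flip_mem_vertex {P : S.Flag → Prop} (h1 : ∀ x, P x → P (S.flip1 x))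
    (h2 : ∀ x, P x → P (S.flip2 x)) {x y : S.Flag} (hxy : S.vertexOf x = S.vertexOf y)
    (hx : P x) : P y := by
  let Q : S.Vertex → Prop := Quot.lift P (by
    rintro a b (rfl | rfl)
    · exact propext ⟨h1 a, fun h => S.flip1_flip1 a ▸ h1 _ h⟩
    · exact propext ⟨h2 a, fun h => S.flip2_flip2 a ▸ h2 _ h⟩)
  exact (congrArg Q hxy).mp hx

/-- The four flags of an edge. -/
noncomputable def edgeFlags (x : S.Flag) : Finset S.Flag :=
  {x, S.flip0 x, S.flip2 x, S.flip0 (S.flip2 x)}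

lemma edgeFlags_flip0 (x : S.Flag) : edgeFlags (S.flip0 x) = edgeFlags x := by
  ext y
  simp only [edgeFlags, mem_insert, mem_singleton, S.flip0_flip0, S.flip0_flip2]
  tauto

lemma edgeFlags_flip2 (x : S.Flag) : edgeFlags (S.flip2 x) = edgeFlags x := by
  ext y
  simp only [edgeFlags, mem_insert, mem_singleton, S.flip2_flip2]
  tauto

lemma edgeOf_eq_iff {x y : S.Flag} : S.edgeOf y = S.edgeOf x ↔ y ∈ edgeFlags x := by
  constructor
  · intro h
    let Q : S.Edge → Finset S.Flag := Quot.lift edgeFlags (by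
      rintro a b (rfl | rfl)
      exacts [(edgeFlags_flip0 a).symm, (edgeFlags_flip2 a).symm])
    have : edgeFlags y = edgeFlags x := congrArg Q h
    rw [← this]
    simp [edgeFlags]
  · simp only [edgeFlags, mem_insert, mem_singleton]
    rintro (rfl | rfl | rfl | rfl)
    · rfl
    · exact edgeOf_flip0 _
    · exact edgeOf_flip2 _
    · rw [edgeOf_flip0, edgeOf_flip2]

lemma sum_edgeFlags {M : Type*} [AddCommMonoid M] (x : S.Flag) (F : S.Flag → M) :
    ∑ y ∈ edgeFlags x, F y = F x + F (S.flip0 x) + F (S.flip2 x) + F (S.flip0 (S.flip2 x)) := by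
  have h0 := S.flip0_ne
  have h2 := S.flip2_ne
  have h02 := S.flip0_flip2_ne
  have h3 : S.flip0 x ≠ S.flip2 x := fun e => h02 x (by rw [← e, S.flip0_flip0])
  have h4 : S.flip0 x ≠ S.flip0 (S.flip2 x) := fun e => h2 x (by
    rw [← S.flip0_flip0 (S.flip2 x), ← e, S.flip0_flip0])
  unfold edgeFlags
  rw [sum_insert, sum_insert, sum_insert, sum_singleton, add_assoc, add_assoc]
  · simpa using (h0 _).symm
  · simpa using ⟨h3, h4⟩
  · simpa using ⟨(h0 x).symm, (h2 x).symm, (h02 x).symm⟩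

lemma sum_flag_eq {M : Type*} [AddCommMonoid M] (F : S.Flag → M) (o : S.Edge → S.Flag)
    (ho : ∀ e, S.edgeOf (o e) = e) : ∑ x, F x = ∑ e, (F (o e) + F (S.flip0 (o e)) +
      F (S.flip2 (o e)) + F (S.flip0 (S.flip2 (o e)))) := by
  rw [← sum_fiberwise univ S.edgeOf F]
  refine sum_congr rfl fun e _ => ?_
  rw [← sum_edgeFlags]
  refine sum_congr ?_ fun _ _ => rfl
  ext x
  rw [mem_filter, ← edgeOf_eq_iff, ho]
  simp

lemma exists_flag_of_edge (e : S.Edge) : ∃ x, S.edgeOf x = e := Quot.exists_rep e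

lemma exists_flag_of_polygon (p : S.Polygon) : ∃ x, S.polygonOf x = p := Quot.exists_rep p

lemma exists_flag_of_vertex (v : S.Vertex) : ∃ x, S.vertexOf x = v := Quot.exists_rep v

lemma exists_flag_of_faceOn (Φ : S.FaceOn A) : ∃ x, S.faceOn A x = Φ := Quot.exists_rep Φ

/-- The Euler inequality for a set of edges `A`, when the vertices are classified by a map that
does not separate the ends of any edge in `A`. -/
theorem card_add_card_le {Y : Type*} [Fintype Y] (r : S.Vertex → Y)
    (hr : Function.Surjective r)
    (hA : ∀ x, S.edgeOf x ∈ A → r (S.vertexOf (S.flip0 x)) = r (S.vertexOf x)) :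
    Fintype.card Y + Fintype.card S.Polygon + A.ncard ≤
      Fintype.card S.Edge + Fintype.card (S.FaceOn A) + 1 := by
  choose o ho using S.exists_flag_of_edge
  choose oF hoF using S.exists_flag_of_faceOn (A := A)
  let a : Y → S.Flag → ZMod 2 := fun y x => if r (S.vertexOf x) = y then 1 else 0
  let b : S.Polygon → S.Flag → ZMod 2 := fun p x => if S.polygonOf x = p then 1 else 0
  -- `D` and `B` are the mod 2 boundary maps, with the edges of `A` omitted and the vertices merged
  -- by `r`. The inequality follows from `rank D + rank B ≤ #(E \ A)`.
  let D : Matrix Y {e // e ∉ A} (ZMod 2) :=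
    Matrix.of fun y e => a y (o e) + a y (S.flip0 (o e))
  let B : Matrix {e // e ∉ A} S.Polygon (ZMod 2) :=
    Matrix.of fun e p => b p (o e) + b p (S.flip2 (o e))
  have hDB : D * B = 0 := by
    ext y p
    -- The flags of a polygon at a vertex pair off under `flip1`. Regrouping this sum by edges
    -- produces the entry of the product of boundary maps.
    have h1 : ∑ x, a y x * b p x = 0 := by
      refine sum_involution (fun x _ => S.flip1 x) (fun x _ => ?_) (fun x _ _ => S.flip1_ne x)
        (fun _ _ => mem_univ _) (fun x _ => S.flip1_flip1 x)
      simp only [a, b, vertexOf_flip1, polygonOf_flip1]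
      exact CharTwo.add_self_eq_zero _
    rw [sum_flag_eq _ o ho] at h1
    rw [Matrix.mul_apply, Matrix.zero_apply, ← h1]
    have h2 : ∀ e, a y (o e) * b p (o e) + a y (S.flip0 (o e)) * b p (S.flip0 (o e)) +
        a y (S.flip2 (o e)) * b p (S.flip2 (o e)) +
        a y (S.flip0 (S.flip2 (o e))) * b p (S.flip0 (S.flip2 (o e))) =
        (a y (o e) + a y (S.flip0 (o e))) * (b p (o e) + b p (S.flip2 (o e))) := by
      intro e
      have h3 : a y (S.flip0 (S.flip2 (o e))) = a y (S.flip0 (o e)) := by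
        simp only [a, S.flip0_flip2, vertexOf_flip2]
      have h4 : a y (S.flip2 (o e)) = a y (o e) := by simp only [a, vertexOf_flip2]
      have h5 : ∀ x, b p (S.flip0 x) = b p x := fun x => by simp only [b, polygonOf_flip0]
      rw [h3, h4, h5, h5]
      ring
    simp only [h2]
    rw [← Fintype.sum_subtype_add_sum_subtype (fun e => e ∉ A)]
    -- The edges of `A` contribute nothing because `r` identifies their ends.
    refine (add_eq_left.2 (sum_eq_zero fun e _ => ?_)).symm
    have he : S.edgeOf (o e) ∈ A := by
      rw [ho]
      exact not_not.1 e.2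
    have h3 : a y (S.flip0 (o e)) = a y (o e) := by simp only [a, hA _ he]
    rw [h3, CharTwo.add_self_eq_zero, zero_mul]
  have hrank := Matrix.rank_add_rank_le_card_of_mul_eq_zero hDB
  obtain ⟨x₀⟩ := S.nonempty_flag
  -- A function annihilated by the transpose agrees at the ends of every edge, so by connectedness
  -- its value at one flag determines it.
  have hD : Fintype.card Y ≤ D.rank + 1 := by
    rw [← Matrix.rank_transpose]
    have := Matrix.card_le_rank_add_one D.transpose
      (LinearMap.proj (R := ZMod 2) (φ := fun _ : Y => ZMod 2) (r (S.vertexOf x₀))) ?_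
    · simpa using this
    intro g hg h0
    have hflip : ∀ x, g (r (S.vertexOf (S.flip0 x))) = g (r (S.vertexOf x)) := by
      intro x
      by_cases hx : S.edgeOf x ∈ A
      · rw [hA x hx]
      have he := congrFun hg ⟨S.edgeOf x, hx⟩
      simp only [Matrix.mulVec, dotProduct, Matrix.transpose_apply, Matrix.of_apply, D, a,
        add_mul, ite_mul, one_mul, zero_mul, sum_add_distrib, sum_ite_eq, mem_univ, if_true,
        Pi.zero_apply] at he
      have he' := CharTwo.add_eq_zero.1 he
      have hmem := edgeOf_eq_iff.1 (ho (S.edgeOf x)).symm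
      simp only [edgeFlags, mem_insert, mem_singleton] at hmem
      set z := o (S.edgeOf x)
      rcases hmem with e | e | e | e <;> rw [e] <;>
        simp only [S.flip0_flip0, S.flip0_flip2, vertexOf_flip2, he']
    funext y
    obtain ⟨v, rfl⟩ := hr y
    obtain ⟨x, rfl⟩ := S.exists_flag_of_vertex v
    refine mem_of_flip_mem (P := fun x => g (r (S.vertexOf x)) = 0) ?_ ?_ ?_ h0 x
    · intro x hx
      rw [hflip, hx]
    · intro x hx
      rw [vertexOf_flip1, hx]
    · intro x hx
      rw [vertexOf_flip2, hx]
  -- The kernel consists of functions that do not change across edges outside `A`; they descend to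
  -- faces, so one sample polygon per face determines them.
  have hB : Fintype.card S.Polygon ≤ B.rank + Fintype.card (S.FaceOn A) := by
    have := Matrix.card_le_rank_add_one B
      (LinearMap.funLeft (ZMod 2) (ZMod 2) fun Φ => S.polygonOf (oF Φ)) ?_
    · simpa using this
    intro h hh h0
    have hflip : ∀ x, S.edgeOf x ∉ A → h (S.polygonOf (S.flip2 x)) = h (S.polygonOf x) := by
      intro x hx
      have he := congrFun hh ⟨S.edgeOf x, hx⟩
      simp only [Matrix.mulVec, dotProduct, Matrix.of_apply, B, b,
        add_mul, ite_mul, one_mul, zero_mul, sum_add_distrib, sum_ite_eq, mem_univ, if_true,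
        Pi.zero_apply] at he
      have he' := CharTwo.add_eq_zero.1 he
      have hmem := edgeOf_eq_iff.1 (ho (S.edgeOf x)).symm
      simp only [edgeFlags, mem_insert, mem_singleton] at hmem
      set z := o (S.edgeOf x)
      rcases hmem with e | e | e | e <;> rw [e] <;>
        simp only [S.flip2_flip2, ← S.flip0_flip2, polygonOf_flip0, he']
    let k : S.FaceOn A → ZMod 2 := Quot.lift (fun x => h (S.polygonOf x)) (by
      rintro x y (rfl | rfl | ⟨rfl, hx⟩)
      · rw [polygonOf_flip0]
      · rw [polygonOf_flip1]
      · rw [hflip x hx])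
    funext p
    obtain ⟨x, rfl⟩ := S.exists_flag_of_polygon p
    have h1 : k (S.faceOn A (oF (S.faceOn A x))) = k (S.faceOn A x) := by rw [hoF]
    have h2 := congrFun h0 (S.faceOn A x)
    exact h1.symm.trans h2
  have hc : Fintype.card {e // e ∉ A} + A.ncard = Fintype.card S.Edge := by
    have := Set.ncard_add_ncard_compl A
    rw [Nat.card_eq_fintype_card] at this
    rw [← this, add_comm, ← Nat.card_eq_fintype_card]
    rfl
  omega

end CellSurface

/-! ### Counting the sides of faces -/

namespace CellSurface

open Finset
open scoped Classical

variable {S : CellSurface} {A : Set S.Edge}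

/-- The flags at the sides of the face `Φ`. -/
noncomputable def sides (Φ : S.FaceOn A) : Finset S.Flag :=
  {x | S.edgeOf x ∈ A ∧ S.faceOn A x = Φ}

lemma mem_sides {Φ : S.FaceOn A} {x : S.Flag} :
    x ∈ sides Φ ↔ S.edgeOf x ∈ A ∧ S.faceOn A x = Φ := by
  simp [sides]

/-- Each edge has four flags and each flag lies in one face. A side of an edge thus counts as two
flags. -/
lemma sum_card_sides : ∑ Φ : S.FaceOn A, #(sides Φ) = 4 * A.ncard := by
  have h1 : ∑ Φ : S.FaceOn A, #(sides Φ) = #{x : S.Flag | S.edgeOf x ∈ A} := by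
    rw [card_eq_sum_card_fiberwise (f := S.faceOn A) (t := univ) (fun _ _ => mem_coe.2 (mem_univ _))]
    refine sum_congr rfl fun Φ _ => ?_
    rw [filter_filter]
    rfl
  choose o ho using S.exists_flag_of_edge
  rw [h1, card_filter, sum_flag_eq _ o ho, Set.ncard_eq_toFinset_card',
    ← filter_univ_mem A.toFinset, card_filter, mul_sum]
  refine sum_congr rfl fun e _ => ?_
  simp only [edgeOf_flip0, edgeOf_flip2, ho, Set.mem_toFinset]
  split_ifs <;> rfl

/-- All flags of the face at `v` pair off under `flip1`, and those failing `p` pair off under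
`flip2`; the remainder is even. It is used both for edges in `A` and for edges with another face on
the other side. -/
lemma even_card_filter_vertex {Φ : S.FaceOn A} {v : S.Vertex} (p : S.Flag → Prop)
    (hA : ∀ x, ¬ p x → S.faceOn A (S.flip2 x) = S.faceOn A x) (hp : ∀ x, S.faceOn A x = Φ →
      S.faceOn A (S.flip2 x) = Φ → p (S.flip2 x) → p x) :
    Even #{x : S.Flag | (S.vertexOf x = v ∧ S.faceOn A x = Φ) ∧ p x} := by
  have h := card_filter_add_card_filter_not
    (s := ({x : S.Flag | S.vertexOf x = v ∧ S.faceOn A x = Φ} : Finset S.Flag)) p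
  have h1 : Even #{x : S.Flag | S.vertexOf x = v ∧ S.faceOn A x = Φ} := by
    refine even_card_of_involution S.flip1 (fun x hx => ?_) (fun x _ => S.flip1_flip1 x)
      (fun x _ => S.flip1_ne x)
    simp only [mem_filter, mem_univ, true_and] at hx ⊢
    rwa [vertexOf_flip1, faceOn_flip1]
  have h2 : Even #{x ∈ ({x : S.Flag | S.vertexOf x = v ∧ S.faceOn A x = Φ} : Finset S.Flag) |
      ¬ p x} := by
    refine even_card_of_involution S.flip2 (fun x hx => ?_) (fun x _ => S.flip2_flip2 x)
      (fun x _ => S.flip2_ne x)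
    simp only [mem_filter, mem_univ, true_and] at hx ⊢
    have := hA x hx.2
    rw [vertexOf_flip2, this]
    exact ⟨hx.1, fun hpx => hx.2 (hp x hx.1.2 (this.trans hx.1.2) hpx)⟩
  rw [← h, Nat.even_add, filter_filter] at h1
  exact h1.2 h2

/-- The boundary of a face passes every vertex of `A` that it contains at least once, that is,
along two sides. -/
theorem two_mul_card_le_card_sides {Φ : S.FaceOn A} (Q : Finset S.Vertex)
    (hΦ : ∀ v ∈ Q, ∃ x, S.vertexOf x = v ∧ S.faceOn A x = Φ)
    (hA : ∀ v ∈ Q, ∃ x, S.vertexOf x = v ∧ S.edgeOf x ∈ A) : 2 * #Q ≤ #(sides Φ) := by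
  have key : ∀ v ∈ Q, 2 ≤ #{x ∈ sides Φ | S.vertexOf x = v} := by
    intro v hv
    have hset : ({x ∈ sides Φ | S.vertexOf x = v} : Finset S.Flag) =
        ({x : S.Flag | (S.vertexOf x = v ∧ S.faceOn A x = Φ) ∧ S.edgeOf x ∈ A} :
          Finset S.Flag) := by
      ext x
      simp only [mem_filter, mem_sides, mem_univ, true_and]
      tauto
    have heven : Even #{x ∈ sides Φ | S.vertexOf x = v} := by
      rw [hset]
      refine even_card_filter_vertex _ (fun x hx => faceOn_flip2 hx) fun x _ _ hx => ?_
      rwa [edgeOf_flip2] at hx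
    obtain ⟨x, hxv, hxΦ⟩ := hΦ v hv
    obtain ⟨y, hyv, hyA⟩ := hA v hv
    -- If no side of `Φ` met `v`, turning around `v` would never leave `Φ`, yet it reaches a flag on
    -- an edge of `A`.
    have hne : ({x ∈ sides Φ | S.vertexOf x = v} : Finset S.Flag).Nonempty := by
      by_contra hempty
      rw [not_nonempty_iff_eq_empty, hset] at hempty
      have hno : ∀ z, S.vertexOf z = v → S.faceOn A z = Φ → S.edgeOf z ∉ A := fun z h1 h2 h3 =>
        notMem_empty z (hempty ▸ mem_filter.2 ⟨mem_univ _, ⟨h1, h2⟩, h3⟩)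
      have := mem_of_flip_mem_vertex (P := fun z => S.vertexOf z = v ∧ S.faceOn A z = Φ)
        (fun z hz => by rwa [vertexOf_flip1, faceOn_flip1])
        (fun z hz => by rwa [vertexOf_flip2, faceOn_flip2 (hno z hz.1 hz.2)])
        (hxv.trans hyv.symm) ⟨hxv, hxΦ⟩
      exact hno y hyv this.2 hyA
    have := hne.card_pos
    obtain ⟨k, hk⟩ := heven
    omega
  calc 2 * #Q = #Q • 2 := by rw [smul_eq_mul, mul_comm]
    _ ≤ ∑ v ∈ Q, #{x ∈ sides Φ | S.vertexOf x = v} := card_nsmul_le_sum _ _ _ key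
    _ = #{x ∈ sides Φ | S.vertexOf x ∈ Q} := by
      rw [card_eq_sum_card_fiberwise (f := S.vertexOf) (t := Q)
        (s := {x ∈ sides Φ | S.vertexOf x ∈ Q})
        (fun x hx => mem_coe.2 (mem_filter.1 (mem_coe.1 hx)).2)]
      refine sum_congr rfl fun v hv => ?_
      rw [filter_filter]
      congr 1
      ext x
      simp only [mem_filter]
      exact ⟨fun ⟨a, b⟩ => ⟨a, b ▸ hv, b⟩, fun ⟨a, _, b⟩ => ⟨a, b⟩⟩
    _ ≤ #(sides Φ) := card_filter_le _ _

/-- The edges in `A` are the edges of a simple graph. -/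
structure IsSimple (A : Set S.Edge) : Prop where
  loopless : ∀ x, S.edgeOf x ∈ A → S.vertexOf (S.flip0 x) ≠ S.vertexOf x
  eq_of_ends : ∀ x y, S.edgeOf x ∈ A → S.edgeOf y ∈ A → S.vertexOf x = S.vertexOf y →
    S.vertexOf (S.flip0 x) = S.vertexOf (S.flip0 y) → S.edgeOf x = S.edgeOf y

/-- A one-sided flag of a face is followed by another one, on a different edge. -/
lemma exists_oneSided (hA : IsSimple A) {x : S.Flag}
    (hx : S.faceOn A (S.flip2 x) ≠ S.faceOn A x) :
    ∃ y, S.vertexOf y = S.vertexOf x ∧ S.faceOn A y = S.faceOn A x ∧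
      S.faceOn A (S.flip2 y) ≠ S.faceOn A y ∧ S.edgeOf y ≠ S.edgeOf x := by
  have hmem : ∀ z, S.faceOn A (S.flip2 z) ≠ S.faceOn A z → S.edgeOf z ∈ A := fun z hz => by
    by_contra hn
    exact hz (faceOn_flip2 hn)
  have heven := even_card_filter_vertex (Φ := S.faceOn A x) (v := S.vertexOf x)
    (fun z => S.faceOn A (S.flip2 z) ≠ S.faceOn A z) (fun z hz => not_not.1 hz)
    (fun z h1 h2 h3 => by rw [S.flip2_flip2] at h3; exact h3.symm)
  set s := ({z : S.Flag | (S.vertexOf z = S.vertexOf x ∧ S.faceOn A z = S.faceOn A x) ∧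
    S.faceOn A (S.flip2 z) ≠ S.faceOn A z} : Finset S.Flag) with hs
  replace heven : Even #s := by convert heven
  have hxs : x ∈ s := mem_filter.2 ⟨mem_univ _, ⟨rfl, rfl⟩, hx⟩
  have h1 : 1 < #s := by
    have := card_pos.2 ⟨x, hxs⟩
    obtain ⟨k, hk⟩ := heven
    omega
  obtain ⟨y, hy, hyx⟩ := exists_mem_ne h1 x
  obtain ⟨-, ⟨hyv, hyf⟩, hyo⟩ := mem_filter.1 hy
  refine ⟨y, hyv, hyf, hyo, fun he => ?_⟩
  -- Of the other flags on the edge of `x`, two lie at its other end, and `flip2 x` lies in another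
  -- face.
  have hyx' := edgeOf_eq_iff.1 he
  simp only [edgeFlags, mem_insert, mem_singleton] at hyx'
  rcases hyx' with rfl | rfl | rfl | rfl
  · exact hyx rfl
  · exact hA.loopless x (hmem x hx) hyv
  · exact hx hyf
  · rw [S.flip0_flip2, vertexOf_flip2] at hyv
    exact hA.loopless x (hmem x hx) hyv

/-- In a simple graph with at least two edges every face has at least three sides. -/
theorem six_le_card_sides (hA : IsSimple A) (h2 : 2 ≤ A.ncard) (Φ : S.FaceOn A) :
    6 ≤ #(sides Φ) := by
  have hmem : ∀ z, S.faceOn A (S.flip2 z) ≠ S.faceOn A z → S.edgeOf z ∈ A := fun z hz => by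
    by_contra hn
    exact hz (faceOn_flip2 hn)
  -- If an edge separates `Φ` from another face, a further such edge continues the boundary at each
  -- of its ends. Otherwise `Φ` is the only face and has all `4 * A.ncard ≥ 8` flags.
  by_cases hone : ∃ x, S.faceOn A x = Φ ∧ S.faceOn A (S.flip2 x) ≠ S.faceOn A x
  · obtain ⟨x, rfl, hx⟩ := hone
    have hx0 : S.faceOn A (S.flip2 (S.flip0 x)) ≠ S.faceOn A (S.flip0 x) := by
      rwa [← S.flip0_flip2, faceOn_flip0, faceOn_flip0]
    obtain ⟨y, hyv, hyf, hyo, hyx⟩ := exists_oneSided hA hx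
    obtain ⟨z, hzv, hzf, hzo, hzx⟩ := exists_oneSided hA hx0
    rw [faceOn_flip0] at hzf
    rw [edgeOf_flip0] at hzx
    have hxA := hmem x hx
    have hyA := hmem y hyo
    have hzA := hmem z hzo
    -- A common edge would be parallel to the edge of `x` or a loop.
    have hyz : S.edgeOf y ≠ S.edgeOf z := by
      intro he
      have hzy := edgeOf_eq_iff.1 he.symm
      have hv : S.vertexOf z = S.vertexOf y ∨ S.vertexOf z = S.vertexOf (S.flip0 y) := by
        simp only [edgeFlags, mem_insert, mem_singleton] at hzy
        rcases hzy with rfl | rfl | rfl | rfl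
        · exact Or.inl rfl
        · exact Or.inr rfl
        · exact Or.inl (vertexOf_flip2 _)
        · exact Or.inr (by rw [S.flip0_flip2, vertexOf_flip2])
      rcases hv with hv | hv
      · exact hA.loopless x hxA (hzv.symm.trans (hv.trans hyv))
      · exact hyx (hA.eq_of_ends y x hyA hxA hyv (hv.symm.trans hzv))
    have hdis : ∀ a b : S.Flag, S.edgeOf a ≠ S.edgeOf b →
        Disjoint ({a, S.flip0 a} : Finset S.Flag) {b, S.flip0 b} := by
      intro a b hab
      have he : ∀ c d, d ∈ ({c, S.flip0 c} : Finset S.Flag) → S.edgeOf d = S.edgeOf c := by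
        intro c d hd
        rw [mem_insert, mem_singleton] at hd
        rcases hd with rfl | rfl
        exacts [rfl, edgeOf_flip0 c]
      rw [Finset.disjoint_left]
      exact fun d hda hdb => hab ((he a d hda).symm.trans (he b d hdb))
    have hcard : ∀ a : S.Flag, #({a, S.flip0 a} : Finset S.Flag) = 2 := fun a =>
      card_pair (S.flip0_ne a).symm
    have hsub : ∀ a, S.edgeOf a ∈ A → S.faceOn A a = S.faceOn A x →
        ({a, S.flip0 a} : Finset S.Flag) ⊆ sides (S.faceOn A x) := by
      intro a ha haf d hd
      rw [mem_insert, mem_singleton] at hd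
      rcases hd with rfl | rfl
      · exact mem_sides.2 ⟨ha, haf⟩
      · exact mem_sides.2 ⟨by rwa [edgeOf_flip0], by rwa [faceOn_flip0]⟩
    have := card_le_card (union_subset (union_subset (hsub x hxA rfl) (hsub y hyA hyf))
      (hsub z hzA hzf))
    rwa [card_union_of_disjoint (disjoint_union_left.2 ⟨hdis x z hzx.symm, hdis y z hyz⟩),
      card_union_of_disjoint (hdis x y hyx.symm), hcard, hcard, hcard] at this
  · push Not at hone
    obtain ⟨x, hx⟩ := S.exists_flag_of_faceOn Φ
    have hall : ∀ y, S.faceOn A y = Φ := mem_of_flip_mem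
      (fun y hy => by rwa [faceOn_flip0]) (fun y hy => by rwa [faceOn_flip1])
      (fun y hy => (hone y hy).trans hy) hx
    have := sum_card_sides (A := A)
    rw [sum_eq_single Φ (fun Ψ _ hne => ?_) (fun h => absurd (mem_univ _) h)] at this
    · omega
    · obtain ⟨y, hy⟩ := S.exists_flag_of_faceOn Ψ
      exact absurd (hy.symm.trans (hall y)) hne

/-- The number of faces of a simple graph is bounded by the number of edges. -/
theorem three_mul_card_faceOn_le (hA : IsSimple A) (h2 : 2 ≤ A.ncard) :
    3 * Fintype.card (S.FaceOn A) ≤ 2 * A.ncard := by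
  have h1 := card_nsmul_le_sum univ (fun Φ : S.FaceOn A => #(sides Φ)) 6
    (fun Φ _ => six_le_card_sides hA h2 Φ)
  rw [sum_card_sides, smul_eq_mul, card_univ] at h1
  omega

/-- The number of faces, given that one of them contains the vertices in `Q`. -/
theorem three_mul_card_faceOn_add_card_le (hA : IsSimple A) (h2 : 2 ≤ A.ncard) {Φ : S.FaceOn A}
    (Q : Finset S.Vertex) (hΦ : ∀ v ∈ Q, ∃ x, S.vertexOf x = v ∧ S.faceOn A x = Φ)
    (hQ : ∀ v ∈ Q, ∃ x, S.vertexOf x = v ∧ S.edgeOf x ∈ A) :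
    3 * Fintype.card (S.FaceOn A) + #Q ≤ 2 * A.ncard + 3 := by
  -- With `f` faces, `6(f - 1) + 2 * #Q ≤ 4 * A.ncard`: the special face is bounded through `Q`, the
  -- others by six flags each.
  have h1 := card_nsmul_le_sum (univ.erase Φ) (fun Φ : S.FaceOn A => #(sides Φ)) 6
    (fun Φ _ => six_le_card_sides hA h2 Φ)
  have h3 := sum_erase_add univ (fun Φ : S.FaceOn A => #(sides Φ)) (mem_univ Φ)
  have h4 := two_mul_card_le_card_sides Q hΦ hQ
  have h5 := card_erase_add_one (mem_univ Φ)
  rw [card_univ] at h5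
  rw [sum_card_sides] at h3
  rw [smul_eq_mul] at h1
  omega

end CellSurface

/-! ### The Heawood number and the genus form of the Euler inequality -/

theorem six_mul_lt_heawood (ε : ℕ) :
    6 * (ε : ℤ) < (heawood ε - 2) * (heawood ε - 3) := by
  have h0 := Real.sqrt_nonneg (24 * (ε : ℝ) + 1)
  have h1 := Nat.lt_floor_add_one ((7 + Real.sqrt (24 * (ε : ℝ) + 1)) / 2)
  change _ < (heawood ε : ℝ) + 1 at h1
  have h2 := Real.sq_sqrt (by positivity : (0 : ℝ) ≤ 24 * (ε : ℝ) + 1)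
  -- The floor gives `√(24ε + 1) < 2H - 5`; this is squared.
  have h3 : 6 * (ε : ℝ) < (heawood ε - 2) * (heawood ε - 3) := by nlinarith
  exact_mod_cast h3

theorem six_le_heawood {ε : ℕ} (hε : 0 < ε) : 6 ≤ heawood ε := by
  have h1 : (1 : ℝ) ≤ ε := by exact_mod_cast hε
  have h2 : (5 : ℝ) ≤ Real.sqrt (24 * (ε : ℝ) + 1) := Real.le_sqrt_of_sq_le (by linarith)
  refine Nat.le_floor ?_
  push_cast
  linarith

namespace CellSurface

/-- The genus eliminates edges and polygons of the decomposition, and fixed points of `r` bound the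
number of classes from below. In the applications `r` collapses each clique to one of its vertices.
-/
theorem card_add_ncard_le (S : CellSurface) {ε : ℕ} (hS : S.eulerGenus = (ε : ℤ))
    {A : Set S.Edge} (r : S.Vertex → S.Vertex)
    (hA : ∀ x, S.edgeOf x ∈ A → r (S.vertexOf (S.flip0 x)) = r (S.vertexOf x))
    (T : Finset S.Vertex) (hT : ∀ v ∈ T, r v = v) :
    T.card + A.ncard + 1 ≤ ε + Fintype.card S.Vertex + Fintype.card (S.FaceOn A) := by
  classical
  have h1 := card_add_card_le (A := A) (Set.rangeFactorization r) Set.rangeFactorization_surjective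
    (fun x hx => Subtype.ext (hA x hx))
  have h2 : T.card ≤ Fintype.card (Set.range r) := by
    rw [← Set.toFinset_card]
    exact Finset.card_le_card fun v hv => Set.mem_toFinset.2 ⟨v, hT v hv⟩
  unfold eulerGenus eulerChar at hS
  rw [Nat.card_eq_fintype_card, Nat.card_eq_fintype_card, Nat.card_eq_fintype_card] at hS
  omega

end CellSurface

/-! ### Complete subgraphs on the surface -/

namespace GraphEmbedding

open Finset CellSurface
open scoped Classical

variable {V : Type*} {G : SimpleGraph V} {S : CellSurface} (φ : GraphEmbedding G S)

/-- The edges of the surface that belong to the subgraph induced on `B`. -/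
def edgesOn (B : Finset V) : Set S.Edge :=
  φ.edgeMap '' {e | ∀ v ∈ e.1, v ∈ B}

variable {φ} {B : Finset V}

lemma edgesOn_subset : φ.edgesOn B ⊆ Set.range φ.edgeMap := Set.image_subset_range _ _

lemma ncard_edgesOn (hB : G.IsClique (B : Set V)) : (φ.edgesOn B).ncard = (#B).choose 2 := by
  unfold edgesOn
  rw [Set.ncard_image_of_injective _ φ.edgeMap_injective,
    ← Set.ncard_image_of_injective _ Subtype.val_injective, ← Sym2.card_image_offDiag,
    ← Set.ncard_coe_finset]
  congr 1
  ext e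
  induction e with | _ a b
  simp only [Set.mem_image, Set.mem_ofPred_eq, Subtype.exists, exists_and_left, exists_prop,
    exists_eq_right_right, SimpleGraph.mem_edgeSet, Sym2.mem_iff, forall_eq_or_imp, forall_eq,
    coe_image, Prod.exists, mem_coe, mem_offDiag]
  constructor
  · rintro ⟨⟨ha, hb⟩, hab⟩
    exact ⟨a, b, ⟨ha, hb, hab.ne⟩, rfl⟩
  · rintro ⟨c, d, ⟨hc, hd, hcd⟩, he⟩
    have hadj := hB hc hd hcd
    rcases Sym2.eq_iff.1 he with ⟨rfl, rfl⟩ | ⟨rfl, rfl⟩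
    exacts [⟨⟨hc, hd⟩, hadj⟩, ⟨⟨hd, hc⟩, hadj.symm⟩]

lemma vertexOf_mem_of_edgeOf_mem {x : S.Flag} (hx : S.edgeOf x ∈ φ.edgesOn B) :
    S.vertexOf x ∈ B.image φ.vertexMap ∧ S.vertexOf (S.flip0 x) ∈ B.image φ.vertexMap := by
  obtain ⟨e, he, hex⟩ := hx
  have h := φ.ends e x hex.symm
  have key : ∀ w, w ∈ s(S.vertexOf x, S.vertexOf (S.flip0 x)) → w ∈ B.image φ.vertexMap := by
    intro w hw
    rw [h, Sym2.mem_map] at hw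
    obtain ⟨v, hv, rfl⟩ := hw
    exact mem_image_of_mem _ (he v hv)
  exact ⟨key _ (Sym2.mem_mk_left _ _), key _ (Sym2.mem_mk_right _ _)⟩

lemma exists_flag_of_isClique (hB : G.IsClique (B : Set V)) {v w : V} (hv : v ∈ B) (hw : w ∈ B)
    (hvw : v ≠ w) : ∃ x, S.vertexOf x = φ.vertexMap v ∧ S.edgeOf x ∈ φ.edgesOn B := by
  have hadj := hB hv hw hvw
  have hmem : φ.edgeMap ⟨s(v, w), hadj⟩ ∈ φ.edgesOn B := by
    refine Set.mem_image_of_mem _ ?_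
    intro u hu
    rcases Sym2.mem_iff.1 hu with rfl | rfl
    exacts [hv, hw]
  obtain ⟨x, hx⟩ := S.exists_flag_of_edge (φ.edgeMap ⟨s(v, w), hadj⟩)
  have h := φ.ends _ x hx
  rw [Sym2.map_mk] at h
  rcases Sym2.eq_iff.1 h with ⟨h1, -⟩ | ⟨-, h1⟩
  · exact ⟨x, h1, hx ▸ hmem⟩
  · exact ⟨S.flip0 x, h1, by rw [edgeOf_flip0, hx]; exact hmem⟩

lemma isSimple {A : Set S.Edge} (hA : A ⊆ Set.range φ.edgeMap) : IsSimple A := by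
  constructor
  · intro x hx h
    obtain ⟨⟨e, he⟩, hex⟩ := hA hx
    have h1 := φ.ends _ x hex.symm
    induction e with | _ a b
    rw [h, Sym2.map_mk] at h1
    have hab : a = b := by
      rcases Sym2.eq_iff.1 h1 with ⟨h2, h3⟩ | ⟨h2, h3⟩
      exacts [φ.vertexMap_injective (h2.symm.trans h3), φ.vertexMap_injective (h3.symm.trans h2)]
    exact G.ne_of_adj he hab
  · intro x y hx hy h h0
    obtain ⟨e, hex⟩ := hA hx
    obtain ⟨e', hey⟩ := hA hy
    have h1 := φ.ends _ x hex.symm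
    rw [h, h0, φ.ends _ y hey.symm] at h1
    have := Subtype.ext (Sym2.map.injective φ.vertexMap_injective h1)
    rw [← hex, ← hey, this]

/-- A face lies in a face of any subgraph. -/
lemma exists_faceOn {A : Set S.Edge} (hA : A ⊆ Set.range φ.edgeMap) (F : φ.Face) :
    ∃ Φ : S.FaceOn A, ∀ x, φ.faceOf x = F → S.faceOn A x = Φ := by
  let f : φ.Face → S.FaceOn A := Quot.lift (S.faceOn A) (by
    rintro x y (rfl | rfl | ⟨rfl, hx⟩)
    · rw [faceOn_flip0]
    · rw [faceOn_flip1]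
    · rw [faceOn_flip2 fun h => hx (hA h)])
  exact ⟨f F, fun x hx => congrArg f hx⟩

lemma choose_two_mul_two (n : ℕ) : (n + 1).choose 2 * 2 = (n + 1) * n := by
  have := Nat.add_one_mul_choose_eq n 1
  rw [Nat.choose_one_right] at this
  exact this.symm

/-- Heawood's bound for complete graphs. -/
theorem card_ne_heawood_add_one {ε : ℕ} (hε : 0 < ε) (hS : S.eulerGenus = (ε : ℤ))
    (φ : GraphEmbedding G S) (hB : G.IsClique (B : Set V)) : #B ≠ heawood ε + 1 := by
  intro hcard
  have hH := six_le_heawood hε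
  have hlt := six_mul_lt_heawood ε
  obtain ⟨b, hb⟩ : B.Nonempty := card_pos.1 (by omega)
  set B' := B.image φ.vertexMap with hB'
  have hcard' : #B' = heawood ε + 1 := by
    rw [hB', card_image_of_injective _ φ.vertexMap_injective, hcard]
  have hb' : φ.vertexMap b ∈ B' := mem_image_of_mem _ hb
  have h1 := S.card_add_ncard_le hS (A := φ.edgesOn B)
    (fun v => if v ∈ B' then φ.vertexMap b else v)
    (fun x hx => by
      obtain ⟨h1, h2⟩ := vertexOf_mem_of_edgeOf_mem hx
      simp only [← hB'] at h1 h2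
      simp only [h1, h2, if_true])
    (insert (φ.vertexMap b) B'ᶜ)
    (fun v hv => by
      rcases mem_insert.1 hv with rfl | hv
      · simp
      · simp [mem_compl.1 hv])
  rw [card_insert_of_notMem (by simpa using hb'), card_compl] at h1
  have h2 := card_le_univ B'
  have hA : (φ.edgesOn B).ncard = (heawood ε + 1).choose 2 := by rw [ncard_edgesOn hB, hcard]
  have hA2 := choose_two_mul_two (heawood ε)
  rw [← hA] at hA2
  have h3 := three_mul_card_faceOn_le (isSimple (φ := φ) edgesOn_subset)
    (show 2 ≤ (φ.edgesOn B).ncard by nlinarith)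
  zify at hA2
  have h4 : (φ.edgesOn B).ncard + 1 ≤ ε + heawood ε + Fintype.card (S.FaceOn (φ.edgesOn B)) := by
    omega
  zify at h4 h3
  -- With `e = H(H + 1)/2` edges and `f` faces, `e + 1 ≤ ε + H + f` and `3f ≤ 2e` give `(H - 2)(H -
  -- 3) ≤ 6ε`.
  nlinarith

/-- A surface does not contain two disjoint complete graphs of almost maximal order such that all
but one of the vertices of each lie on a common face. -/
theorem not_two_cliques {ε : ℕ} (hε : 0 < ε) (hS : S.eulerGenus = (ε : ℤ))
    (φ : GraphEmbedding G S) (F : φ.Face) {B₁ B₂ : Finset V} (hB₁ : G.IsClique (B₁ : Set V))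
    (hB₂ : G.IsClique (B₂ : Set V)) (hdis : Disjoint B₁ B₂) (hc₁ : #B₁ = heawood ε - 1)
    (hc₂ : #B₂ = heawood ε - 1) {x₁ x₂ : V} (hx₁ : x₁ ∈ B₁) (hx₂ : x₂ ∈ B₂)
    (hF₁ : ∀ v ∈ B₁.erase x₁, v ∈ φ.faceVertices F)
    (hF₂ : ∀ v ∈ B₂.erase x₂, v ∈ φ.faceVertices F) : False := by
  have hH := six_le_heawood hε
  have hlt := six_mul_lt_heawood ε
  set A := φ.edgesOn B₁ ∪ φ.edgesOn B₂ with hAdef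
  have hAsub : A ⊆ Set.range φ.edgeMap := Set.union_subset edgesOn_subset edgesOn_subset
  set B₁' := B₁.image φ.vertexMap with hB₁'
  set B₂' := B₂.image φ.vertexMap with hB₂'
  have hdis' : Disjoint B₁' B₂' := (disjoint_image φ.vertexMap_injective).2 hdis
  have hx₁' : φ.vertexMap x₁ ∈ B₁' := mem_image_of_mem _ hx₁
  have hx₂' : φ.vertexMap x₂ ∈ B₂' := mem_image_of_mem _ hx₂
  have hx₂n : φ.vertexMap x₂ ∉ B₁' := fun h => Finset.disjoint_left.1 hdis' h hx₂'
  have hc₁' : #B₁' = heawood ε - 1 := by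
    rw [hB₁', card_image_of_injective _ φ.vertexMap_injective, hc₁]
  have hc₂' : #B₂' = heawood ε - 1 := by
    rw [hB₂', card_image_of_injective _ φ.vertexMap_injective, hc₂]
  have hA : A.ncard = (heawood ε - 1).choose 2 + (heawood ε - 1).choose 2 := by
    rw [hAdef, Set.ncard_union_eq, ncard_edgesOn hB₁, ncard_edgesOn hB₂, hc₁, hc₂]
    rw [Set.disjoint_left]
    intro e he₁ he₂
    obtain ⟨x, rfl⟩ := S.exists_flag_of_edge e
    exact Finset.disjoint_left.1 hdis' (vertexOf_mem_of_edgeOf_mem he₁).1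
      (vertexOf_mem_of_edgeOf_mem he₂).1
  have h1 := S.card_add_ncard_le hS (A := A)
    (fun v => if v ∈ B₁' then φ.vertexMap x₁ else if v ∈ B₂' then φ.vertexMap x₂ else v)
    (fun x hx => by
      rcases hx with hx | hx
      · obtain ⟨h1, h2⟩ := vertexOf_mem_of_edgeOf_mem hx
        simp only [← hB₁'] at h1 h2
        simp only [h1, h2, if_true]
      · obtain ⟨h1, h2⟩ := vertexOf_mem_of_edgeOf_mem hx
        simp only [← hB₂'] at h1 h2
        simp only [h1, h2, if_true, Finset.disjoint_right.1 hdis' h1,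
          Finset.disjoint_right.1 hdis' h2, if_false])
    (insert (φ.vertexMap x₁) (insert (φ.vertexMap x₂) (B₁' ∪ B₂')ᶜ))
    (fun v hv => by
      rcases mem_insert.1 hv with rfl | hv
      · simp [hx₁']
      rcases mem_insert.1 hv with rfl | hv
      · simp [hx₂n]
      · rw [mem_compl, mem_union, not_or] at hv
        simp [hv.1, hv.2])
  rw [card_insert_of_notMem, card_insert_of_notMem, card_compl, card_union_of_disjoint hdis'] at h1
  rotate_left
  · simp [hx₂']
  · rw [mem_insert, not_or]
    exact ⟨fun e => hx₂n (e ▸ hx₁'), by simp [hx₁']⟩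
  have h2 := card_le_univ (B₁' ∪ B₂')
  rw [card_union_of_disjoint hdis'] at h2
  obtain ⟨Φ, hΦ⟩ := exists_faceOn hAsub F
  obtain ⟨h, hh⟩ : ∃ h, heawood ε = h + 2 := ⟨heawood ε - 2, by omega⟩
  have hA2 := choose_two_mul_two h
  rw [show heawood ε - 1 = h + 1 by omega] at hA hc₁ hc₂ hc₁' hc₂'
  rw [hh] at hH hlt
  have hdisQ : Disjoint (B₁.erase x₁) (B₂.erase x₂) :=
    hdis.mono (erase_subset _ _) (erase_subset _ _)
  have h3 := three_mul_card_faceOn_add_card_le (isSimple hAsub)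
    (show 2 ≤ A.ncard by nlinarith) (Φ := Φ)
    ((B₁.erase x₁ ∪ B₂.erase x₂).image φ.vertexMap)
    (by
      intro v hv
      obtain ⟨u, hu, rfl⟩ := mem_image.1 hv
      have hu' : u ∈ φ.faceVertices F := (mem_union.1 hu).elim (hF₁ u) (hF₂ u)
      obtain ⟨x, hx, hxF⟩ := hu'
      exact ⟨x, hx, hΦ x hxF⟩)
    (by
      intro v hv
      obtain ⟨u, hu, rfl⟩ := mem_image.1 hv
      rcases mem_union.1 hu with hu | hu
      · obtain ⟨x, hx, hxA⟩ := exists_flag_of_isClique (φ := φ) hB₁ (mem_of_mem_erase hu) hx₁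
          (ne_of_mem_erase hu)
        exact ⟨x, hx, Or.inl hxA⟩
      · obtain ⟨x, hx, hxA⟩ := exists_flag_of_isClique (φ := φ) hB₂ (mem_of_mem_erase hu) hx₂
          (ne_of_mem_erase hu)
        exact ⟨x, hx, Or.inr hxA⟩)
  rw [card_image_of_injective _ φ.vertexMap_injective, card_union_of_disjoint hdisQ,
    card_erase_of_mem hx₁, card_erase_of_mem hx₂, hc₁, hc₂] at h3
  -- Two disjoint cliques form two classes, whence the 3 rather than the 2 of a connected graph.
  have h4 : A.ncard + 3 ≤ ε + 2 * (h + 1) + Fintype.card (S.FaceOn A) := by omega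
  have h5 : A.ncard = (h + 1) * h := by omega
  have h6 : 3 * Fintype.card (S.FaceOn A) + 2 * h ≤ 2 * A.ncard + 3 := by omega
  zify at h4 h5 h6 hH
  push_cast at hlt
  -- The three bounds give `h² - 3h ≤ 3ε`, while `6ε < h(h - 1)`; together `h < 5`. The case `h = 4`
  -- needs integrality: the face count is at most 11, so `ε ≥ 2`, against `6ε < 12`.
  rcases eq_or_lt_of_le hH with he | hgt
  · have h7 : (h : ℤ) = 4 := by linarith
    rw [h7] at h4 h5 h6 hlt
    omega
  · have h7 : (0 : ℤ) ≤ h * (h - 5) := mul_nonneg (by omega) (by omega)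
    linarith

end GraphEmbedding

/-! ### Excluding bad components -/

open Finset SimpleGraph in
theorem lemma3p2 {V C : Type*} [Fintype V] (G : SimpleGraph V) [DecidableRel G.Adj]
    (ε : ℕ) (hε : 0 < ε) (S : CellSurface) (hS : S.eulerGenus = (ε : ℤ))
    (φ : GraphEmbedding G S) (F : φ.Face) (L : V → Finset C)
    (hdeg : ∀ v, (G.degree v = heawood ε - 2 ∧ (L v).card = heawood ε - 2) ∨
      (G.degree v = heawood ε ∧ (L v).card = heawood ε))
    (hF : ∀ v, G.degree v = heawood ε - 2 → v ∈ φ.faceVertices F)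
    (hK : (G.induce (φ.faceVertices F)).CliqueFree (heawood ε - 1)) :
    ListColorable G L := by
  classical
  have hH := six_le_heawood hε
  rcases isEmpty_or_nonempty V with hV | ⟨⟨v₀⟩⟩
  · exact ⟨⟨fun v => hV.elim v, fun {v} => hV.elim v⟩, fun v => hV.elim v⟩
  obtain ⟨c₀, -⟩ : (L v₀).Nonempty := by
    rw [← card_pos]
    rcases hdeg v₀ with h | h <;> omega
  have : Nonempty C := ⟨c₀⟩
  have hdegOn : ∀ v, G.degreeOn univ v = G.degree v := by
    intro v
    unfold degreeOn
    rw [← card_neighborFinset_eq_degree]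
    congr 1
    ext u
    simp
  by_contra hcol
  obtain ⟨T, hT, hbad⟩ := G.exists_isBad (S := univ) (L := L)
    (fun v _ => by
      rw [hdegOn]
      rcases hdeg v with h | h <;> omega)
    (fun ⟨c, hcL, hc⟩ => hcol ⟨⟨c, fun {u v} huv => hc u (mem_univ _) v (mem_univ _) huv⟩,
      fun v => hcL v (mem_univ _)⟩)
  have hdegT : ∀ v ∈ T, G.degreeOn T v = G.degree v := fun v hv => by
    rw [← hdegOn, degreeOn_eq_of_closed (subset_univ _) (hT.2 v hv)]
  have hface : ∀ v, G.degree v + 1 = heawood ε - 1 → v ∈ φ.faceVertices F := fun v hv =>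
    hF v (by omega)
  -- A vertex with all its neighbors in the brick has degree at least 4 there, which rules out the
  -- 2-regular case.
  have hbrick : ∀ B : Finset V, G.IsBrick B → ∀ b ∈ B, G.degreeOn B b = G.degree b →
      G.IsClique (B : Set V) ∧ #B = heawood ε - 1 := by
    intro B hB b hb hbd
    rcases hB with hB | hB
    · refine ⟨hB, ?_⟩
      rw [degreeOn_of_isClique hB hb] at hbd
      have := card_pos.2 ⟨b, hb⟩
      rcases hdeg b with h | h
      · omega
      · exact absurd (by omega) (φ.card_ne_heawood_add_one hε hS hB)
    · have := hB b hb
      rcases hdeg b with h | h <;> omega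
  have hend : ∀ B x, G.IsEndBrick T B x → G.IsClique (B : Set V) ∧ #B = heawood ε - 1 ∧
      ∀ v ∈ B.erase x, G.degree v + 1 = heawood ε - 1 := by
    intro B x hB
    have hd : ∀ v ∈ B.erase x, G.degreeOn B v = G.degree v := fun v hv => by
      rw [← hdegT v (hB.subset (mem_of_mem_erase hv)),
        degreeOn_eq_of_closed hB.subset (hB.adj_mem v hv)]
    obtain ⟨b, hb⟩ := hB.nonempty
    obtain ⟨hcl, hcard⟩ := hbrick B hB.isBrick b (mem_of_mem_erase hb) (hd b hb)
    refine ⟨hcl, hcard, fun v hv => ?_⟩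
    rw [← hd v hv, degreeOn_of_isClique hcl (mem_of_mem_erase hv)]
    omega
  rcases hbad.isBrick_or_hasTwoEndBricks with hB | ⟨B₁, x₁, B₂, x₂, h₁, h₂, hdis⟩
  · obtain ⟨b, hb⟩ := hbad.nonempty
    obtain ⟨hcl, hcard⟩ := hbrick T hB b hb (hdegT b hb)
    have hTF : ∀ v ∈ T, v ∈ φ.faceVertices F := fun v hv => hface v (by
      rw [← hdegT v hv, degreeOn_of_isClique hcl hv]
      omega)
    refine hK (T.subtype (· ∈ φ.faceVertices F)) ⟨?_, ?_⟩
    · intro u hu v hv huv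
      exact hcl (mem_subtype.1 hu) (mem_subtype.1 hv) (fun e => huv (Subtype.ext e))
    · rw [card_subtype, filter_true_of_mem hTF, hcard]
  · obtain ⟨hcl₁, hc₁, hd₁⟩ := hend B₁ x₁ h₁
    obtain ⟨hcl₂, hc₂, hd₂⟩ := hend B₂ x₂ h₂
    have hce₁ := card_erase_add_one h₁.mem
    have hce₂ := card_erase_add_one h₂.mem
    -- If `x` were interior to `B'`, all of `B` would lie in `B'`; disjoint interiors then leave
    -- only `x'` for `B - x`, which has `H - 2 ≥ 4` vertices.
    have hnot : ∀ {B B' : Finset V} {x x' : V}, G.IsEndBrick T B x → G.IsEndBrick T B' x' →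
        Disjoint (B.erase x) (B'.erase x') → G.IsClique (B : Set V) → #B = heawood ε - 1 →
        x ∉ B'.erase x' := by
      intro B B' x x' hB hB' hdis hcl hc hx
      have hsub : B.erase x ⊆ {x'} := by
        intro b hb
        have hbB : b ∈ B := mem_of_mem_erase hb
        have hadj : G.Adj x b := hcl hB.mem hbB (ne_of_mem_erase hb).symm
        have hbB' := hB'.adj_mem x hx b (hB.subset hbB) hadj
        by_contra hne
        exact Finset.disjoint_left.1 hdis hb (mem_erase.2 ⟨fun e => hne (mem_singleton.2 e), hbB'⟩)
      have h1 := card_le_card hsub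
      have h2 := card_erase_add_one hB.mem
      rw [card_singleton] at h1
      omega
    have hn₁ := hnot h₁ h₂ hdis hcl₁ hc₁
    have hn₂ := hnot h₂ h₁ hdis.symm hcl₂ hc₂
    -- A common attaching vertex would have degree at least `2(H - 2) > H`.
    have hxx : x₁ ≠ x₂ := by
      rintro rfl
      have hsub : B₁.erase x₁ ∪ B₂.erase x₁ ⊆ G.neighborFinset x₁ := by
        intro b hb
        rw [mem_neighborFinset]
        rcases mem_union.1 hb with hb | hb
        · exact hcl₁ h₁.mem (mem_of_mem_erase hb) (ne_of_mem_erase hb).symm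
        · exact hcl₂ h₂.mem (mem_of_mem_erase hb) (ne_of_mem_erase hb).symm
      have h1 := card_le_card hsub
      rw [card_union_of_disjoint hdis, card_neighborFinset_eq_degree] at h1
      rcases hdeg x₁ with h | h <;> omega
    have hdisB : Disjoint B₁ B₂ := by
      rw [Finset.disjoint_left]
      intro b hb₁ hb₂
      rcases eq_or_ne b x₁ with rfl | hne₁
      · exact hn₁ (mem_erase.2 ⟨hxx, hb₂⟩)
      · rcases eq_or_ne b x₂ with rfl | hne₂
        · exact hn₂ (mem_erase.2 ⟨hxx.symm, hb₁⟩)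
        · exact Finset.disjoint_left.1 hdis (mem_erase.2 ⟨hne₁, hb₁⟩) (mem_erase.2 ⟨hne₂, hb₂⟩)
    exact φ.not_two_cliques hε hS F hcl₁ hcl₂ hdisB hc₁ hc₂ h₁.mem h₂.mem
      (fun v hv => hface v (hd₁ v hv)) (fun v hv => hface v (hd₂ v hv))
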